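/- **Definition.** An *$f$-category* is a triangulated category $T$ together with a quadruple $(T(\le 0), T(\ge 0), s, \iota)$, where $T(\le 0), T(\ge 0)$ are strictly full triangulated subcategories, $s : T \to T$ is an exact (triangulated) auto-equivalence and $\iota : \mathrm{id}_T \to s$ is a natural transformation, such that, with $T(\le n) := s^n T(\le 0)$ and $T(\ge n) := s^n T(\ge 0)$ for $n \in \mathbb{Z}$ (closed under isomorphism): 1. $T(\le 0) \subset T(\le 1)$, $T(\ge 1) \subset T(\ge 0)$, and $T = \bigcup_{n} T(\le n) = \bigcup_{n} T(\ge n)$; 2. for every $X \in T$ one has $\iota_X = s(\iota_{s^{-1}X})$; 3. for $X \in T(\ge 1)$ and $Y \in T(\le 0)$ one has $\operatorname{Hom}(X,Y) = 0$, and $\iota_* : \operatorname{Hom}(Y, s^{-1}X) \to \operatorname{Hom}(Y,X)$ and $\iota^* : \operatorname{Hom}(sY,X) \to \operatorname{Hom}(Y,X)$ are isomorphisms; 4. for every $X \in T$ there is an exact triangle $A \to X \to B \to A[1]$ with $A \in T(\ge 1)$ and $B \in T(\le 0)$. An *$f$-category over* a triangulated category $\mathcal{C}$ is a pair $(T, \jmath)$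 of an $f$-category $T$ and an equivalence of triangulated categories $\jmath : \mathcal{C} \to T(\le 0) \cap T(\ge 0)$. A *sub-$f$-category* of $T$ is a strictly full triangulated subcategory $P \subset T$, stable under $s$, which is an $f$-category for the restricted quadruple $(P \cap T(\le 0), P \cap T(\ge 0), s|_P, \iota|_P)$. **Setting.** Let $\mathcal{A}$ be an exact category (an additive category with a class of short exact sequences satisfying Quillen's axioms). Let $D(\mathcal{A})$ be its unbounded derived category, the Verdier quotient of the homotopy category $K(\mathcal{A})$ of complexes by the thick subcategory generated by the acyclic complexes. Let $DF(\mathcal{A})$ be the filtered derived category: take complexes $A^*$ over $\mathcal{A}$ with a finite decreasing filtration $F^\bullet$, indexed by $\mathbb{Z}$, by subcomplexes all of whose inclusions $F^i \to F^j$ ($j \le i$) are admissible monomorphisms in each degree; form their homotopy category, and localize it at the morphisms $f$ for which every $\mathrm{Gr}^i f$ is an isomorphism in $D(\mathcal{A})$. Here $\mathrm{Gr}^i = F^i/F^{i+1}$. Put $$DF(\mathcal{A})(\le 0) = \{X : \mathrm{Gr}^i X = 0 \text{ in } D(\mathcal{A})\ \forall\, i > 0\}, \qquad DF(\mathcal{A})(\ge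 0) = \{X : \mathrm{Gr}^i X = 0 \text{ in } D(\mathcal{A})\ \forall\, i < 0\},$$ let $s$ be the shift of the filtration $(A^*, F^\bullet) \mapsto (A^*, F^{\bullet-1})$, let $\iota : \mathrm{id} \to s$ be given by the identity on the underlying complexes, and let $\jmath : D(\mathcal{A}) \to DF(\mathcal{A})$ be given by the trivial filtration concentrated in degree $0$. **Corollary.** Let $\mathcal{A}$ be an exact category and $\mathcal{C}$ a full triangulated subcategory of $D(\mathcal{A})$. Then the embedding of $\mathcal{C}$ into $D(\mathcal{A})$ induces a choice of $f$-category over $\mathcal{C}$. Precisely: $DF(\mathcal{A})$ with the above quadruple, together with $\jmath$, is an $f$-category over $D(\mathcal{A})$, and there is a unique sub-$f$-category $\mathcal{C}F$ of $DF(\mathcal{A})$ such that $\jmath$ maps $\mathcal{C}$ into $\mathcal{C}F$ and $\mathcal{C}F$, together with the restriction of $\jmath$ to $\mathcal{C}$, is an $f$-category over $\mathcal{C}$. -/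

import Mathlib

open CategoryTheory Category Limits Pretriangulated ZeroObject

universe v u

set_option linter.unusedSectionVars false

noncomputable section

/-! ### f-categories -/

section FCategories

/-- The data underlying an f-category: a quadruple `(T(≤ 0), T(≥ 0), s, ι)` on a triangulated
category `T`, where `s` is a functor which commutes with the translation. The axioms are stated in
`FData.IsFCategory`. -/
structure FData (T : Type*) [Category* T] [HasShift T ℤ] where
  /-- the subcategory `T(≤ 0)` -/
  le : ObjectProperty T
  /-- the subcategory `T(≥ 0)` -/
  ge : ObjectProperty T
  /-- the functor `s` -/
  s : T ⥤ T
  [commShift : s.CommShift ℤ]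
  /-- the natural transformation from the identity to `s` -/
  ι : 𝟭 T ⟶ s

namespace FData

attribute [instance] FData.commShift

variable {T : Type*} [Category* T] [HasZeroObject T] [HasShift T ℤ] [Preadditive T]
  [∀ n : ℤ, (shiftFunctor T n).Additive] [Pretriangulated T] (f : FData T)

/-- `T(≤ n) = sⁿ T(≤ 0)` for `n : ℤ` (closed under isomorphisms). -/
def leAt [f.s.IsEquivalence] (n : ℤ) : ObjectProperty T :=
  f.le.map (f.s.asEquivalence ^ n).functor

/-- `T(≥ n) = sⁿ T(≥ 0)` for `n : ℤ` (closed under isomorphisms). -/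
def geAt [f.s.IsEquivalence] (n : ℤ) : ObjectProperty T :=
  f.ge.map (f.s.asEquivalence ^ n).functor

/-- The functor `s⁻¹`. -/
abbrev sInv [f.s.IsEquivalence] : T ⥤ T := f.s.asEquivalence.inverse

/-- The isomorphism `s (s⁻¹ X) ≅ X`. -/
abbrev sCounit [f.s.IsEquivalence] (X : T) : f.s.obj (f.sInv.obj X) ≅ X :=
  f.s.asEquivalence.counitIso.app X

/-- The axioms of an f-category (also called a filtered triangulated category). -/
structure IsFCategory : Prop where
  isTriangulated : IsTriangulated T
  [isTriangulated_le : f.le.IsTriangulated]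
  [isClosedUnderIsomorphisms_le : f.le.IsClosedUnderIsomorphisms]
  [isTriangulated_ge : f.ge.IsTriangulated]
  [isClosedUnderIsomorphisms_ge : f.ge.IsClosedUnderIsomorphisms]
  [isEquivalence_s : f.s.IsEquivalence]
  isTriangulated_s : f.s.IsTriangulated
  le_zero_le_one : f.leAt 0 ≤ f.leAt 1
  ge_one_le_zero : f.geAt 1 ≤ f.geAt 0
  exists_leAt (X : T) : ∃ n : ℤ, f.leAt n X
  exists_geAt (X : T) : ∃ n : ℤ, f.geAt n X
  /-- `ι_X = s (ι_{s⁻¹ X})`, where `s (s⁻¹ X)` is identified with `X` -/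
  iota_app (X : T) : f.ι.app X =
    (f.sCounit X).inv ≫ f.s.map (f.ι.app (f.sInv.obj X)) ≫ f.s.map (f.sCounit X).hom
  hom_eq_zero {X Y : T} (hX : f.geAt 1 X) (hY : f.le Y) (φ : X ⟶ Y) : φ = 0
  /-- `ι` induces an isomorphism `Hom(Y, s⁻¹ X) ≅ Hom(Y, X)` -/
  bijective_comp_iota {X Y : T} (hX : f.geAt 1 X) (hY : f.le Y) :
    Function.Bijective (fun φ : Y ⟶ f.sInv.obj X =>
      φ ≫ f.ι.app (f.sInv.obj X) ≫ (f.sCounit X).hom)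
  /-- `ι` induces an isomorphism `Hom(s Y, X) ≅ Hom(Y, X)` -/
  bijective_iota_comp {X Y : T} (hX : f.geAt 1 X) (hY : f.le Y) :
    Function.Bijective (fun φ : f.s.obj Y ⟶ X => f.ι.app Y ≫ φ)
  exists_triangle (X : T) : ∃ (A B : T) (a : A ⟶ X) (b : X ⟶ B) (c : B ⟶ A⟦(1 : ℤ)⟧),
    Triangle.mk a b c ∈ distTriang T ∧ f.geAt 1 A ∧ f.le B

section

variable {C : Type*} [Category* C] [HasZeroObject C] [HasShift C ℤ] [Preadditive C]
  [∀ n : ℤ, (shiftFunctor C n).Additive] [Pretriangulated C] (j : C ⥤ T) [j.CommShift ℤ]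

/-- `(T, j)` is an f-category over `C`: `T` is an f-category and `j` induces an equivalence of
triangulated categories from `C` to the full subcategory `T(≤ 0) ∩ T(≥ 0)` of `T`. -/
structure IsFCategoryOver : Prop extends f.IsFCategory where
  mem (X : C) : (f.le ⊓ f.ge) (j.obj X)
  isTriangulated_lift : ((f.le ⊓ f.ge).lift j mem).IsTriangulated
  isEquivalence_lift : ((f.le ⊓ f.ge).lift j mem).IsEquivalence

end

/-- The restriction of the quadruple `(T(≤ 0), T(≥ 0), s, ι)` to a full triangulated subcategory
which is stable under `s`. -/
def restrict (P : ObjectProperty T) [P.IsTriangulated] (hP : ∀ X, P X → P (f.s.obj X)) :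
    FData P.FullSubcategory where
  le := f.le.inverseImage P.ι
  ge := f.ge.inverseImage P.ι
  s := P.lift (P.ι ⋙ f.s) (fun X => hP X.obj X.property)
  ι :=
    { app := fun X => ObjectProperty.homMk (f.ι.app X.obj)
      naturality := fun X Y g => by
        ext
        exact f.ι.naturality g.hom }

section

variable {C : Type*} [Category* C] [HasZeroObject C] [HasShift C ℤ] [Preadditive C]
  [∀ n : ℤ, (shiftFunctor C n).Additive] [Pretriangulated C] (j : C ⥤ T) [j.CommShift ℤ]

/-- Given `T` with its quadruple `(T(≤ 0), T(≥ 0), s, ι)`, a functor `j : C ⥤ T`, and a full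
triangulated subcategory `D` of `C`, this is the condition that `P` is a (strictly full) sub-f-category
of `T`, i.e. a triangulated subcategory which is an f-category for the restricted quadruple,
and that, together with the restriction of `j` to `D`, it is an f-category over `D`. -/
structure IsSubFCategoryOver (D : ObjectProperty C) [D.IsTriangulated]
    (P : ObjectProperty T) : Prop where
  [isClosedUnderIsomorphisms : P.IsClosedUnderIsomorphisms]
  [isTriangulated : P.IsTriangulated]
  s_mem (X : T) : P X → P (f.s.obj X)
  j_mem (X : C) : D X → P (j.obj X)
  isFCategoryOver : (f.restrict P s_mem).IsFCategoryOver
    (P.lift (D.ι ⋙ j) (fun X => j_mem X.obj X.property))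

end

end FData

end FCategories

section ExactCategories

variable {A : Type u} [Category.{v} A] [Preadditive A]

/-- The admissible monomorphisms attached to a class of short sequences: those `i` which occur as
the first map of a sequence of the class. -/
def admissibleMono (conflation : ObjectProperty (ShortComplex A)) : MorphismProperty A :=
  fun _ Y i => ∃ (Z : A) (p : Y ⟶ Z) (w : i ≫ p = 0), conflation (ShortComplex.mk i p w)

/-- The admissible epimorphisms attached to a class of short sequences: those `p` which occur as
the second map of a sequence of the class. -/
def admissibleEpi (conflation : ObjectProperty (ShortComplex A)) : MorphismProperty A :=
  fun Y _ p => ∃ (X : A) (i : X ⟶ Y) (w : i ≫ p = 0), conflation (ShortComplex.mk i p w)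

variable (A) in
/-- An exact structure (in the sense of Quillen) on an additive category `A`: a class of sequences
`X ⟶ Y ⟶ Z`, called conflations (or short exact sequences). -/
structure ExactStructure where
  /-- the class of short exact sequences -/
  conflation : ObjectProperty (ShortComplex A)
  of_iso : ∀ {S T : ShortComplex A}, (S ≅ T) → conflation S → conflation T
  of_splitting : ∀ {S : ShortComplex A}, S.Splitting → conflation S
  isKernel : ∀ {S : ShortComplex A}, conflation S → Nonempty (IsLimit (KernelFork.ofι S.f S.zero))
  isCokernel : ∀ {S : ShortComplex A}, conflation S →
    Nonempty (IsColimit (CokernelCofork.ofπ S.g S.zero))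
  mono_comp : ∀ {X Y Z : A} (i : X ⟶ Y) (j : Y ⟶ Z), admissibleMono conflation i →
    admissibleMono conflation j → admissibleMono conflation (i ≫ j)
  epi_comp : ∀ {X Y Z : A} (p : X ⟶ Y) (q : Y ⟶ Z), admissibleEpi conflation p →
    admissibleEpi conflation q → admissibleEpi conflation (p ≫ q)
  mono_cobaseChange : ∀ {X Y X' : A} (i : X ⟶ Y) (f : X ⟶ X'), admissibleMono conflation i →
    ∃ (Y' : A) (f' : Y ⟶ Y') (i' : X' ⟶ Y'), IsPushout i f f' i' ∧ admissibleMono conflation i'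
  epi_baseChange : ∀ {Y Z Z' : A} (p : Y ⟶ Z) (f : Z' ⟶ Z), admissibleEpi conflation p →
    ∃ (Y' : A) (f' : Y' ⟶ Y) (p' : Y' ⟶ Z'), IsPullback f' p' p f ∧ admissibleEpi conflation p'
  mono_of_comp : ∀ {X Y Z : A} (i : X ⟶ Y) (g : Y ⟶ Z), HasCokernel i →
    admissibleMono conflation (i ≫ g) → admissibleMono conflation i
  epi_of_comp : ∀ {X Y Z : A} (g : X ⟶ Y) (p : Y ⟶ Z), HasKernel p →
    admissibleEpi conflation (g ≫ p) → admissibleEpi conflation p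

namespace ExactStructure

variable (E : ExactStructure A)

/-- The admissible monomorphisms (inflations) of an exact category. -/
abbrev inflation : MorphismProperty A := admissibleMono E.conflation

lemma inflation_of_isIso {X Y : A} (i : X ⟶ Y) [IsIso i] [HasZeroObject A] : E.inflation i :=
  ⟨0, 0, by simp, E.of_splitting
    { r := inv i, s := 0, f_r := by simp, s_g := (isZero_zero A).eq_of_src _ _, id := by simp }⟩

lemma inflation_of_isZero {X Y : A} (i : X ⟶ Y) (hX : IsZero X) : E.inflation i :=
  ⟨Y, 𝟙 Y, hX.eq_of_src _ _, E.of_splitting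
    { r := 0, s := 𝟙 Y, f_r := hX.eq_of_src _ _, s_g := by simp, id := by simp }⟩

lemma hasCokernel_of_inflation {X Y : A} (i : X ⟶ Y) (hi : E.inflation i) : HasCokernel i := by
  obtain ⟨Z, p, w, h⟩ := hi
  exact ⟨⟨_, (E.isCokernel h).some⟩⟩

lemma inflation_biprod_map_id [HasZeroObject A] [HasBinaryBiproducts A] {X Y : A} (i : X ⟶ Y)
    (hi : E.inflation i) (Z : A) : E.inflation (biprod.map i (𝟙 Z)) := by
  obtain ⟨Y', f', i', h, hi'⟩ := E.mono_cobaseChange i (biprod.inl : X ⟶ X ⊞ Z) hi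
  have h₂ : IsPushout i biprod.inl (biprod.inl : Y ⟶ Y ⊞ Z) (biprod.map i (𝟙 Z)) :=
    { w := by simp
      isColimit' := ⟨PushoutCocone.IsColimit.mk _
        (fun s => biprod.desc s.inl (biprod.inr ≫ s.inr)) (by simp)
        (fun s => by ext <;> simp [s.condition]) (fun s m h₁ h₂ => by
          ext
          · simp [h₁]
          · simp [← h₂])⟩ }
  have := E.mono_comp i' (h.isoIsPushout _ _ h₂).hom hi' (E.inflation_of_isIso _)
  rwa [h.inr_isoIsPushout_hom] at this

lemma inflation_biprod_map [HasZeroObject A] [HasBinaryBiproducts A] {X Y X' Y' : A} (i : X ⟶ Y)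
    (i' : X' ⟶ Y') (hi : E.inflation i) (hi' : E.inflation i') :
    E.inflation (biprod.map i i') := by
  have h₁ := E.inflation_biprod_map_id i hi X'
  have h₂ : E.inflation (biprod.map (𝟙 Y) i') := by
    have := E.mono_comp _ _ (E.mono_comp _ _
      (E.inflation_of_isIso (biprod.braiding Y X').hom) (E.inflation_biprod_map_id i' hi' Y))
      (E.inflation_of_isIso (biprod.braiding Y' Y).hom)
    convert this using 1
    ext <;> simp
  convert E.mono_comp _ _ h₁ h₂ using 1
  ext <;> simp

/-! ### Filtered objects -/

/-- The property that a decreasing sequence `⋯ ⟶ F¹ ⟶ F⁰ ⟶ F⁻¹ ⟶ ⋯` is a filtration, i.e. that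
all transition morphisms are admissible monomorphisms. -/
def isFiltration : ObjectProperty (ℤᵒᵖ ⥤ A) :=
  fun F => ∀ ⦃i j : ℤᵒᵖ⦄ (f : i ⟶ j), E.inflation (F.map f)

/-- The additive category of decreasing `ℤ`-indexed filtrations by admissible monomorphisms. -/
abbrev Fil := E.isFiltration.FullSubcategory

/-- The functor `F ↦ Fⁱ`. -/
def filStep (i : ℤ) : E.Fil ⥤ A where
  obj F := F.obj.obj (Opposite.op i)
  map f := f.hom.app (Opposite.op i)

/-- The transition morphisms `Fⁱ ⟶ Fʲ` of a filtration, for `j ≤ i`. -/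
def filTrans (i j : ℤ) (h : j ≤ i) : E.filStep i ⟶ E.filStep j where
  app F := F.obj.map (homOfLE h).op
  naturality _ _ f := (f.hom.naturality _).symm

lemma inflation_filTrans (i j : ℤ) (h : j ≤ i) (F : E.Fil) :
    E.inflation ((E.filTrans i j h).app F) := F.property _

instance (i j : ℤ) (h : j ≤ i) (F : E.Fil) : HasCokernel ((E.filTrans i j h).app F) :=
  E.hasCokernel_of_inflation _ (E.inflation_filTrans i j h F)

/-- The `i`-th graded piece `Grⁱ F = Fⁱ / Fⁱ⁺¹` of a filtration. -/
def gr (i : ℤ) : E.Fil ⥤ A where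
  obj F := cokernel ((E.filTrans (i + 1) i (by lia)).app F)
  map f := cokernel.map _ _ ((E.filStep (i + 1)).map f) ((E.filStep i).map f)
    ((E.filTrans (i + 1) i (by lia)).naturality f).symm

instance (i : ℤ) : (E.filStep i).Additive where

/-- The projection `Fⁱ ⟶ Grⁱ F`. -/
def grπ (i : ℤ) : E.filStep i ⟶ E.gr i where
  app F := cokernel.π ((E.filTrans (i + 1) i (by lia)).app F)
  naturality _ _ _ := (cokernel.π_desc _ _ _).symm

instance (i : ℤ) (F : E.Fil) : Epi ((E.grπ i).app F) :=
  inferInstanceAs (Epi (cokernel.π _))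

section

variable {E} {i : ℤ} {F : E.Fil} {Z : A} (φ : (E.filStep i).obj F ⟶ Z)
  (hφ : (E.filTrans (i + 1) i (by lia)).app F ≫ φ = 0)

/-- Constructor for morphisms from `Grⁱ F`. -/
def grDesc : (E.gr i).obj F ⟶ Z := cokernel.desc _ φ hφ

lemma grπ_grDesc : (E.grπ i).app F ≫ grDesc φ hφ = φ := cokernel.π_desc _ _ _

lemma grπ_grDesc_assoc {W : A} (ψ : Z ⟶ W) : (E.grπ i).app F ≫ grDesc φ hφ ≫ ψ = φ ≫ ψ :=
  cokernel.π_desc_assoc _ _ _ _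

end

lemma filTrans_grπ (i j : ℤ) (hj : j = i + 1) (F : E.Fil) :
    (E.filTrans j i (by lia)).app F ≫ (E.grπ i).app F = 0 := by
  subst hj
  exact cokernel.condition _

instance (i : ℤ) : (E.gr i).Additive where
  map_add {F G f g} := by
    rw [← cancel_epi ((E.grπ i).app F), ← NatTrans.naturality, Preadditive.comp_add,
      ← NatTrans.naturality, ← NatTrans.naturality, Functor.map_add, Preadditive.add_comp]

/-- The functor `i ↦ i - 1` on the index category. -/
def predOp : ℤᵒᵖ ⥤ ℤᵒᵖ where
  obj i := Opposite.op (i.unop - 1)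
  map f := (homOfLE (sub_le_sub_right f.unop.le 1)).op

/-- The shift of filtrations: `(sF)ⁱ = Fⁱ⁻¹`. -/
def filShift : E.Fil ⥤ E.Fil :=
  E.isFiltration.lift
    (E.isFiltration.ι ⋙ (Functor.whiskeringLeft ℤᵒᵖ ℤᵒᵖ A).obj predOp)
    (fun F _ _ _ => F.property _)

instance : E.filShift.Additive where

/-- The natural transformation `F ⟶ sF` whose components are the inclusions `Fⁱ ⟶ Fⁱ⁻¹`: it is
the identity on the objects which are being filtered. -/
def filIota : 𝟭 E.Fil ⟶ E.filShift where
  app F := ObjectProperty.homMk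
    { app := fun i => F.obj.map (homOfLE (by simp : i.unop - 1 ≤ i.unop)).op
      naturality := fun i j f =>
        (F.obj.map_comp _ _).symm.trans (F.obj.map_comp _ (predOp.map f)) }
  naturality F G f := by
    ext i
    exact (f.hom.naturality _).symm

/-- `Grⁱ (sF) = Grⁱ⁻¹ F`. -/
def filShiftCompGr (i : ℤ) : E.filShift ⋙ E.gr i ≅ E.gr (i - 1) :=
  NatIso.ofComponents (fun F =>
    { hom := grDesc (F := E.filShift.obj F) ((E.grπ (i - 1)).app F)
        (E.filTrans_grπ (i - 1) (i + 1 - 1) (by lia) F)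
      inv := grDesc ((E.grπ i).app (E.filShift.obj F)) (by
        have h : (E.filTrans (i - 1 + 1) (i - 1) (by lia)).app F =
            F.obj.map (homOfLE (by lia : i + 1 - 1 ≤ i - 1 + 1)).op ≫
              (E.filTrans (i + 1) i (by lia)).app (E.filShift.obj F) :=
          (congr_arg F.obj.map (Subsingleton.elim _ _)).trans (F.obj.map_comp _ _)
        rw [h]
        exact (assoc _ _ _).trans
          ((congr_arg _ (E.filTrans_grπ i (i + 1) rfl (E.filShift.obj F))).trans comp_zero))
      hom_inv_id := by
        refine (cancel_epi ((E.grπ i).app (E.filShift.obj F))).1 ?_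
        exact (grπ_grDesc_assoc _ _ _).trans ((grπ_grDesc _ _).trans (comp_id _).symm)
      inv_hom_id := by
        refine (cancel_epi ((E.grπ (i - 1)).app F)).1 ?_
        exact (grπ_grDesc_assoc _ _ _).trans ((grπ_grDesc _ _).trans (comp_id _).symm) })
    (fun {F G} f => by
      refine (cancel_epi ((E.grπ i).app (E.filShift.obj F))).1 ?_
      have h₁ := (E.grπ i).naturality (E.filShift.map f)
      have h₂ := (E.grπ (i - 1)).naturality f
      dsimp only [Functor.comp_map]
      rw [← reassoc_of% h₁]
      refine (congr_arg _ (grπ_grDesc _ _)).trans (h₂.trans ?_)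
      exact (grπ_grDesc_assoc (F := E.filShift.obj F) ((E.grπ (i - 1)).app F) _ _).symm)

lemma isZero_gr {i : ℤ} {F : E.Fil} (h : Epi ((E.filTrans (i + 1) i (by lia)).app F)) :
    IsZero ((E.gr i).obj F) := by
  rw [IsZero.iff_id_eq_zero, ← cancel_epi ((E.grπ i).app F),
    ← cancel_epi ((E.filTrans (i + 1) i _).app F), ← assoc, E.filTrans_grπ i (i + 1) rfl,
    zero_comp, comp_zero, comp_zero]

section Zero

variable [HasZeroObject A]

/-- The trivial filtration on `X`, concentrated in degree zero: it is `X` in degrees `≤ 0` and zero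
in degrees `> 0`. -/
def trivialSeq (X : A) : ℤᵒᵖ ⥤ A where
  obj i := if i.unop ≤ 0 then X else 0
  map {i j} f := if hi : i.unop ≤ 0 then
      eqToHom (by rw [if_pos hi, if_pos (f.unop.le.trans hi)]) else 0
  map_id i := by
    by_cases hi : i.unop ≤ 0
    · simp [hi]
    · rw [dif_neg hi]
      refine IsZero.eq_of_src ?_ _ _
      rw [if_neg hi]
      exact isZero_zero A
  map_comp {i j k} f g := by
    by_cases hi : i.unop ≤ 0
    · rw [dif_pos hi, dif_pos hi, dif_pos (f.unop.le.trans hi), eqToHom_trans]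
    · rw [dif_neg hi, dif_neg hi, zero_comp]

lemma isZero_trivialSeq_obj (X : A) (i : ℤᵒᵖ) (hi : ¬ i.unop ≤ 0) :
    IsZero ((trivialSeq X).obj i) := by
  dsimp [trivialSeq]
  rw [if_neg hi]
  exact isZero_zero A

/-- The identification of the trivial filtration with the object `X` in degrees `≤ 0`. -/
def trivialSeqObjIso (X : A) (i : ℤᵒᵖ) (hi : i.unop ≤ 0) :
    (trivialSeq X).obj i ≅ X := eqToIso (if_pos hi)

lemma trivialSeq_map_comp (X : A) {i j : ℤᵒᵖ} (f : i ⟶ j) (hi : i.unop ≤ 0)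
    (hj : j.unop ≤ 0) :
    (trivialSeq X).map f ≫ (trivialSeqObjIso X j hj).hom = (trivialSeqObjIso X i hi).hom := by
  simp [trivialSeq, trivialSeqObjIso, hi]

lemma isIso_trivialSeq_map (X : A) {i j : ℤᵒᵖ} (f : i ⟶ j) (hi : i.unop ≤ 0) :
    IsIso ((trivialSeq X).map f) := by
  have h := trivialSeq_map_comp X f hi (f.unop.le.trans hi)
  rw [← Iso.eq_comp_inv] at h
  rw [h]
  infer_instance

/-- The trivial filtration, concentrated in degree zero, as a functor. -/
def trivialFil : A ⥤ E.Fil where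
  obj X :=
    { obj := trivialSeq X
      property := fun i j f => by
        by_cases hi : i.unop ≤ 0
        · have := isIso_trivialSeq_map X f hi
          exact E.inflation_of_isIso _
        · exact E.inflation_of_isZero _ (isZero_trivialSeq_obj X i hi) }
  map {X Y} g := ObjectProperty.homMk
    { app := fun i => if hi : i.unop ≤ 0 then
        (trivialSeqObjIso X i hi).hom ≫ g ≫ (trivialSeqObjIso Y i hi).inv else 0
      naturality := fun i j f => by
        by_cases hi : i.unop ≤ 0
        · have hj : j.unop ≤ 0 := f.unop.le.trans hi
          rw [dif_pos hi, dif_pos hj, ← cancel_mono (trivialSeqObjIso Y j hj).hom,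
            ← trivialSeq_map_comp X f hi hj]
          simp [trivialSeq_map_comp Y f hi hj]
        · exact (isZero_trivialSeq_obj X i hi).eq_of_src _ _ }
  map_id X := by
    ext i
    by_cases hi : i.unop ≤ 0
    · simp [hi]
    · exact (isZero_trivialSeq_obj X i hi).eq_of_src _ _
  map_comp f g := by
    ext i
    by_cases hi : i.unop ≤ 0
    · simp [hi]
    · exact (isZero_trivialSeq_obj _ i hi).eq_of_src _ _

lemma trivialFil_map_app {X Y : A} (g : X ⟶ Y) (i : ℤ) (hi : i ≤ 0) :
    (E.filStep i).map (E.trivialFil.map g) =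
      (trivialSeqObjIso X (Opposite.op i) hi).hom ≫ g ≫
        (trivialSeqObjIso Y (Opposite.op i) hi).inv :=
  dif_pos hi

instance : E.trivialFil.Additive where
  map_add {X Y f g} := by
    ext i
    by_cases hi : i.unop ≤ 0
    · refine (E.trivialFil_map_app (f + g) i.unop hi).trans ?_
      refine Eq.trans ?_ (congr_arg₂ (· + ·) (E.trivialFil_map_app f i.unop hi)
        (E.trivialFil_map_app g i.unop hi)).symm
      rw [Preadditive.add_comp, Preadditive.comp_add]
      rfl
    · exact (isZero_trivialSeq_obj X i hi).eq_of_src _ _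

/-- The trivial filtration has only one graded piece, in degree `0`. -/
lemma isZero_gr_trivialFil (i : ℤ) (hi : i ≠ 0) (X : A) :
    IsZero ((E.gr i).obj (E.trivialFil.obj X)) := by
  apply isZero_gr
  by_cases h : i ≤ 0
  · have hi : i + 1 ≤ 0 := by lia
    have := isIso_trivialSeq_map X (homOfLE (by lia : i ≤ i + 1)).op hi
    exact inferInstanceAs (Epi ((trivialSeq X).map (homOfLE (by lia : i ≤ i + 1)).op))
  · exact ⟨fun _ _ _ => (isZero_trivialSeq_obj X (Opposite.op i) h).eq_of_src _ _⟩

/-- `Gr⁰` of the trivial filtration is the identity. -/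
def trivialFilCompGr : E.trivialFil ⋙ E.gr 0 ≅ 𝟭 A :=
  NatIso.ofComponents (fun X =>
    { hom := grDesc (F := E.trivialFil.obj X)
        (trivialSeqObjIso X (Opposite.op 0) le_rfl).hom
        ((isZero_trivialSeq_obj X (Opposite.op (0 + 1)) (by simp)).eq_of_src _ _)
      inv := (trivialSeqObjIso X (Opposite.op 0) le_rfl).inv ≫
        (E.grπ 0).app (E.trivialFil.obj X)
      hom_inv_id := by
        refine (cancel_epi ((E.grπ 0).app (E.trivialFil.obj X))).1 ?_
        refine (grπ_grDesc_assoc _ _ _).trans ?_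
        exact (Iso.hom_inv_id_assoc _ _).trans (comp_id _).symm
      inv_hom_id := by
        refine (assoc _ _ _).trans ?_
        refine (congr_arg _ (grπ_grDesc _ _)).trans ?_
        exact Iso.inv_hom_id _ })
    (fun {X Y} f => by
      refine (cancel_epi ((E.grπ 0).app (E.trivialFil.obj X))).1 ?_
      have h := (E.grπ 0).naturality (E.trivialFil.map f)
      dsimp only [Functor.comp_map]
      refine (assoc _ _ _).symm.trans ((congr_arg (· ≫ _) h.symm).trans ?_)
      refine (assoc _ _ _).trans ((congr_arg _ (grπ_grDesc _ _)).trans ?_)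
      refine (congr_arg (· ≫ _) (E.trivialFil_map_app f 0 le_rfl)).trans ?_
      refine Eq.trans ?_ (grπ_grDesc_assoc (F := E.trivialFil.obj X)
        (trivialSeqObjIso X (Opposite.op 0) le_rfl).hom
        ((isZero_trivialSeq_obj X (Opposite.op (0 + 1)) (by simp)).eq_of_src _ _) f).symm
      refine (assoc _ _ _).trans (congr_arg _ ?_)
      refine (assoc _ _ _).trans ?_
      exact (congr_arg _ (Iso.inv_hom_id _)).trans (comp_id _))

variable [HasBinaryBiproducts A]

instance : E.isFiltration.ContainsZero where
  exists_zero := ⟨0, isZero_zero _, fun i _ _ =>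
    E.inflation_of_isZero _ ((Functor.isZero_iff _).1 (isZero_zero _) i)⟩

instance : E.isFiltration.IsClosedUnderIsomorphisms where
  of_iso {F G} e hF i j f := by
    have : G.map f = e.inv.app i ≫ F.map f ≫ e.hom.app j := by simp
    rw [this]
    exact E.mono_comp _ _ (E.inflation_of_isIso _)
      (E.mono_comp _ _ (hF f) (E.inflation_of_isIso _))

lemma isFiltration_biprod (F G : ℤᵒᵖ ⥤ A) (hF : E.isFiltration F) (hG : E.isFiltration G) :
    E.isFiltration (F ⊞ G) := by
  intro i j f
  let e (k : ℤᵒᵖ) : (F ⊞ G).obj k ≅ F.obj k ⊞ G.obj k :=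
    { hom := biprod.lift ((biprod.fst : F ⊞ G ⟶ F).app k) ((biprod.snd : F ⊞ G ⟶ G).app k)
      inv := biprod.desc ((biprod.inl : F ⟶ F ⊞ G).app k) ((biprod.inr : G ⟶ F ⊞ G).app k)
      hom_inv_id := by
        rw [biprod.lift_desc, ← NatTrans.comp_app, ← NatTrans.comp_app, ← NatTrans.app_add,
          biprod.total, NatTrans.id_app]
      inv_hom_id := by
        ext <;> simp [← NatTrans.comp_app] }
  have : (F ⊞ G).map f = (e i).hom ≫ biprod.map (F.map f) (G.map f) ≫ (e j).inv := by
    rw [← assoc, Iso.eq_comp_inv]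
    ext <;> simp [e]
  rw [this]
  have := (e i).isIso_hom
  have := (e j).isIso_inv
  exact E.mono_comp _ _ (E.inflation_of_isIso _)
    (E.mono_comp _ _ (E.inflation_biprod_map _ _ (hF f) (hG f)) (E.inflation_of_isIso _))

instance : HasBinaryBiproducts E.Fil := ⟨fun F G => HasBinaryBiproduct.mk
  { bicone :=
      { pt := ⟨F.obj ⊞ G.obj, E.isFiltration_biprod _ _ F.property G.property⟩
        fst := ObjectProperty.homMk biprod.fst
        snd := ObjectProperty.homMk biprod.snd
        inl := ObjectProperty.homMk biprod.inl
        inr := ObjectProperty.homMk biprod.inr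
        inl_fst := by ext1; exact biprod.inl_fst
        inl_snd := by ext1; exact biprod.inl_snd
        inr_fst := by ext1; exact biprod.inr_fst
        inr_snd := by ext1; exact biprod.inr_snd }
    isBilimit := isBinaryBilimitOfTotal _ (by ext1; exact biprod.total) }⟩

instance : HasZeroObject E.Fil := inferInstance

end Zero

/-! ### The derived category -/

section Derived

variable [HasZeroObject A] [HasBinaryBiproducts A]

lemma isZero_zero_X (n : ℤ) : IsZero ((0 : CochainComplex A ℤ).X n) :=
  (HomologicalComplex.eval A (ComplexShape.up ℤ) n).map_isZero (isZero_zero _)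

/-- A cochain complex over an exact category is acyclic if each differential `Xⁿ ⟶ Xⁿ⁺¹` factors
as `Xⁿ ⟶ Zⁿ⁺¹ ⟶ Xⁿ⁺¹` in such a way that all `Zⁿ ⟶ Xⁿ ⟶ Zⁿ⁺¹` are short exact sequences. -/
def IsAcyclic (X : CochainComplex A ℤ) : Prop :=
  ∃ (Z : ℤ → A) (m : ∀ n, Z n ⟶ X.X n) (e : ∀ n, X.X n ⟶ Z (n + 1)) (w : ∀ n, m n ≫ e n = 0),
    (∀ n, e n ≫ m (n + 1) = X.d n (n + 1)) ∧ ∀ n, E.conflation (ShortComplex.mk (m n) (e n) (w n))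

/-- The acyclic complexes, in the homotopy category. -/
def acyclic : ObjectProperty (HomotopyCategory A (ComplexShape.up ℤ)) := fun X => E.IsAcyclic X.as

instance : E.acyclic.Nonempty :=
  ⟨⟨(HomotopyCategory.quotient A (ComplexShape.up ℤ)).obj 0, fun _ => 0, fun _ => 0, fun _ => 0,
    fun _ => by simp, fun n => (isZero_zero_X _).eq_of_tgt _ _, fun n => E.of_splitting
      { r := 0
        s := 0
        f_r := (isZero_zero A).eq_of_tgt _ _
        s_g := (isZero_zero A).eq_of_tgt _ _
        id := (isZero_zero_X _).eq_of_tgt _ _ }⟩⟩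

/-- The thick triangulated subcategory of the homotopy category generated by the acyclic
complexes, i.e. the complexes which become zero in the derived category. -/
abbrev acyclicThick : ObjectProperty (HomotopyCategory A (ComplexShape.up ℤ)) :=
  E.acyclic.triangEnvelope

/-- The (unbounded) derived category `D(A)` of an exact category `A`: the Verdier quotient of the
homotopy category of complexes by the acyclic complexes. -/
abbrev D := E.acyclicThick.trW.Localization

/-- The localization functor `K(A) ⥤ D(A)`. -/
abbrev Q : HomotopyCategory A (ComplexShape.up ℤ) ⥤ E.D := E.acyclicThick.trW.Q

/-! ### The filtered derived category -/

/-- A complex of filtered objects is finitely filtered if `Fⁱ = 0` for `i` large and all the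
inclusions `Fⁱ ⟶ Fʲ`, for `j ≤ i` small, are isomorphisms (with bounds independent of the degree
in the complex). Such an object amounts to a complex `X` (the common value of `Fⁱ` for `i` small)
equipped with a finite decreasing filtration by (admissible) subcomplexes `Fⁱ`. -/
def IsFinitelyFiltered (X : CochainComplex E.Fil ℤ) : Prop :=
  ∃ a b : ℤ, (∀ (i n : ℤ), b ≤ i → IsZero ((E.filStep i).obj (X.X n))) ∧
    ∀ (i j n : ℤ) (h : j ≤ i), i ≤ a → IsIso ((E.filTrans i j h).app (X.X n))

/-- The finitely filtered complexes, in the homotopy category. -/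
def finitelyFiltered : ObjectProperty (HomotopyCategory E.Fil (ComplexShape.up ℤ)) :=
  fun X => E.IsFinitelyFiltered X.as

lemma IsFinitelyFiltered.shift {X : CochainComplex E.Fil ℤ} (hX : E.IsFinitelyFiltered X) (n : ℤ) :
    E.IsFinitelyFiltered (X⟦n⟧) := by
  obtain ⟨a, b, h₁, h₂⟩ := hX
  exact ⟨a, b, fun i m hi => h₁ i (m + n) hi, fun i j m h hi => h₂ i j (m + n) h hi⟩

lemma isIso_app_biprod {C : Type*} [Category* C] [Preadditive C]
    {F G : C ⥤ A} [F.Additive] [G.Additive] (τ : F ⟶ G)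
    (X Y : C) [HasBinaryBiproduct X Y] [IsIso (τ.app X)] [IsIso (τ.app Y)] :
    IsIso (τ.app (X ⊞ Y)) := by
  refine ⟨G.map biprod.fst ≫ inv (τ.app X) ≫ F.map biprod.inl +
    G.map biprod.snd ≫ inv (τ.app Y) ≫ F.map biprod.inr, ?_, ?_⟩
  · rw [Preadditive.comp_add, ← NatTrans.naturality_assoc, ← NatTrans.naturality_assoc,
      IsIso.hom_inv_id_assoc, IsIso.hom_inv_id_assoc, ← F.map_comp, ← F.map_comp, ← F.map_add,
      biprod.total, F.map_id]
  · simp only [Preadditive.add_comp, assoc, NatTrans.naturality, IsIso.inv_hom_id_assoc]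
    rw [← G.map_comp, ← G.map_comp, ← G.map_add, biprod.total, G.map_id]

lemma IsFinitelyFiltered.mappingCone {X Y : CochainComplex E.Fil ℤ} (f : X ⟶ Y)
    (hX : E.IsFinitelyFiltered X) (hY : E.IsFinitelyFiltered Y) :
    E.IsFinitelyFiltered (CochainComplex.mappingCone f) := by
  obtain ⟨a, b, h₁, h₂⟩ := hX
  obtain ⟨a', b', h₁', h₂'⟩ := hY
  let e (n : ℤ) : (CochainComplex.mappingCone f).X n ≅ X.X (n + 1) ⊞ Y.X n :=
    HomologicalComplex.homotopyCofiber.XIsoBiprod f n (n + 1) rfl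
  refine ⟨min a a', max b b', fun i n hi => ?_, fun i j n h hi => ?_⟩
  · refine IsZero.of_iso ?_ ((E.filStep i).mapIso (e n))
    have h₀ := h₁ i (n + 1) (le_of_max_le_left hi)
    have h₀' := h₁' i n (le_of_max_le_right hi)
    rw [IsZero.iff_id_eq_zero, ← (E.filStep i).map_id, ← biprod.total, Functor.map_add,
      Functor.map_comp, Functor.map_comp, h₀.eq_of_tgt ((E.filStep i).map biprod.fst) 0,
      h₀'.eq_of_tgt ((E.filStep i).map biprod.snd) 0, zero_comp, zero_comp, add_zero]
  · have := h₂ i j (n + 1) h (hi.trans (min_le_left _ _))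
    have := h₂' i j n h (hi.trans (min_le_right _ _))
    have := isIso_app_biprod (E.filTrans i j h) (X.X (n + 1)) (Y.X n)
    exact (NatTrans.isIso_app_iff_of_iso _ (e n)).2 this

instance : E.finitelyFiltered.ContainsZero where
  exists_zero := ⟨(HomotopyCategory.quotient _ _).obj 0, Functor.map_isZero _ (isZero_zero _),
    0, 0, fun i n _ => (E.filStep i).map_isZero (isZero_zero_X n),
    fun i j n h _ => by
      have h₁ := (E.filStep i).map_isZero (isZero_zero_X n)
      have h₂ := (E.filStep j).map_isZero (isZero_zero_X n)
      exact ⟨0, h₁.eq_of_src _ _, h₂.eq_of_tgt _ _⟩⟩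

instance : E.finitelyFiltered.IsStableUnderShift ℤ where
  isStableUnderShiftBy n :=
    { le_shift X hX := by
        obtain ⟨X : CochainComplex _ _, rfl⟩ := X.quotient_obj_surjective
        rw [ObjectProperty.prop_shift_iff, HomotopyCategory.shift_quotient_obj]
        exact IsFinitelyFiltered.shift E hX n }

instance : E.finitelyFiltered.IsTriangulatedClosed₃ where
  ext₃' T hT h₁ h₂ := by
    obtain ⟨f : T.obj₁.as ⟶ T.obj₂.as, hf⟩ :=
      (HomotopyCategory.quotient _ _).map_surjective T.mor₁
    refine ⟨_, ?_,
      ⟨Triangle.π₃.mapIso (isoTriangleOfIso₁₂ T _ hT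
        (HomotopyCategory.mappingCone_triangleh_distinguished f)
        (Iso.refl _) (Iso.refl _) ?_)⟩⟩
    · exact IsFinitelyFiltered.mappingCone E f h₁ h₂
    · exact (comp_id _).trans (hf.symm.trans (id_comp _).symm)

instance : E.finitelyFiltered.IsTriangulated where
  toIsTriangulatedClosed₂ := .of_isTriangulatedClosed₃

/-- The homotopy category of finitely filtered complexes. -/
abbrev KF := E.finitelyFiltered.FullSubcategory

/-- The functor which sends a finitely filtered complex to the class in `D(A)` of its `i`-th
graded piece. -/
def grKF (i : ℤ) : E.KF ⥤ E.D :=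
  E.finitelyFiltered.ι ⋙ (E.gr i).mapHomotopyCategory (ComplexShape.up ℤ) ⋙ E.Q

instance (i : ℤ) : (E.grKF i).CommShift ℤ := by dsimp only [grKF]; infer_instance

instance (i : ℤ) : (E.grKF i).IsTriangulated := by dsimp only [grKF]; infer_instance

/-- The finitely filtered complexes which are filtered acyclic: all of their graded pieces are zero
in `D(A)`. -/
def filteredAcyclic : ObjectProperty E.KF := fun X => ∀ i, IsZero ((E.grKF i).obj X)

instance : E.filteredAcyclic.IsClosedUnderIsomorphisms where
  of_iso e hX i := (hX i).of_iso ((E.grKF i).mapIso e.symm)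

instance : E.filteredAcyclic.IsTriangulated where
  exists_zero := ⟨0, isZero_zero _, fun i => (E.grKF i).map_isZero (isZero_zero _)⟩
  isStableUnderShiftBy n :=
    { le_shift X hX i := ((shiftFunctor E.D n).map_isZero (hX i)).of_iso
        (((E.grKF i).commShiftIso n).app X) }
  toIsTriangulatedClosed₂ := .mk' (fun T hT h₁ h₃ i =>
    Triangle.isZero₂_of_isZero₁₃ _ ((E.grKF i).map_distinguished T hT) (h₁ i) (h₃ i))

/-- The filtered derived category `DF(A)` of an exact category `A`: the Verdier quotient of the
homotopy category of finitely filtered complexes by the filtered acyclic ones, i.e. its localization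
with respect to the morphisms `f` such that all `Grⁱ f` become invertible in `D(A)`. -/
abbrev DF := E.filteredAcyclic.trW.Localization

/-- The localization functor from finitely filtered complexes to `DF(A)`. -/
abbrev QF : E.KF ⥤ E.DF := E.filteredAcyclic.trW.Q

lemma filteredAcyclic_trW_iff {X Y : E.KF} (f : X ⟶ Y) :
    E.filteredAcyclic.trW f ↔ ∀ i, IsIso ((E.grKF i).map f) := by
  obtain ⟨Z, g, h, hT⟩ := distinguished_cocone_triangle f
  have h₁ := E.filteredAcyclic.trW_iff_of_distinguished _ hT
  exact Iff.trans h₁ (forall_congr' fun i =>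
    (Triangle.isZero₃_iff_isIso₁ _ ((E.grKF i).map_distinguished _ hT)))

/-- The functor `Grⁱ : DF(A) ⥤ D(A)`. -/
def grDF (i : ℤ) : E.DF ⥤ E.D :=
  Localization.lift (E.grKF i)
    (fun _ _ f hf => (E.filteredAcyclic_trW_iff f).1 hf i) E.QF

lemma finitelyFiltered_filShift (X : HomotopyCategory E.Fil (ComplexShape.up ℤ))
    (hX : E.finitelyFiltered X) :
    E.finitelyFiltered ((E.filShift.mapHomotopyCategory (ComplexShape.up ℤ)).obj X) := by
  obtain ⟨a, b, h₁, h₂⟩ := hX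
  exact ⟨a + 1, b + 1, fun i n hi => h₁ (i - 1) n (by lia),
    fun i j n h hi => h₂ (i - 1) (j - 1) n (by lia) (by lia)⟩

/-- The shift of filtrations, on the homotopy category of finitely filtered complexes. -/
def shiftKF : E.KF ⥤ E.KF :=
  E.finitelyFiltered.lift
    (E.finitelyFiltered.ι ⋙ E.filShift.mapHomotopyCategory (ComplexShape.up ℤ))
    (fun X => E.finitelyFiltered_filShift X.obj X.property)

instance : E.shiftKF.CommShift ℤ := by dsimp only [shiftKF]; infer_instance

/-- `Grⁱ (sX) = Grⁱ⁻¹ X`. -/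
def shiftKFCompGr (i : ℤ) : E.shiftKF ⋙ E.grKF i ≅ E.grKF (i - 1) :=
  Functor.isoWhiskerLeft E.finitelyFiltered.ι (Functor.isoWhiskerRight
    (Functor.mapHomotopyCategoryCompIso (E.filShiftCompGr i) (ComplexShape.up ℤ)) E.Q)

/-- The shift of filtrations preserves filtered quasi-isomorphisms. -/
def shiftLocalizer : LocalizerMorphism E.filteredAcyclic.trW E.filteredAcyclic.trW where
  functor := E.shiftKF
  map X Y f hf := by
    rw [filteredAcyclic_trW_iff] at hf
    refine (E.filteredAcyclic_trW_iff _).2 fun i => ?_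
    exact (NatIso.isIso_map_iff (E.shiftKFCompGr i) f).2 (hf (i - 1))

instance : E.shiftLocalizer.functor.CommShift ℤ := inferInstanceAs (E.shiftKF.CommShift ℤ)

/-- The functor `s : DF(A) ⥤ DF(A)` given by the shift of filtrations
`(X, F^•) ↦ (X, F^{• - 1})`. -/
def shiftDF : E.DF ⥤ E.DF := E.shiftLocalizer.localizedFunctor E.QF E.QF

instance : E.shiftDF.CommShift ℤ :=
  inferInstanceAs ((E.shiftLocalizer.localizedFunctor E.QF E.QF).CommShift ℤ)

/-- The functor `s` is computed on complexes as the shift of filtrations. -/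
def QFCompShiftDF : E.shiftKF ⋙ E.QF ≅ E.QF ⋙ E.shiftDF :=
  CatCommSq.iso E.shiftLocalizer.functor E.QF E.QF
    (E.shiftLocalizer.localizedFunctor E.QF E.QF)

/-- The transformation `X ⟶ sX`, on the homotopy category of finitely filtered complexes. -/
def iotaKF : 𝟭 E.KF ⟶ E.shiftKF where
  app X := ObjectProperty.homMk
    ((HomotopyCategory.quotient E.Fil (ComplexShape.up ℤ)).map
      ((NatTrans.mapHomologicalComplex E.filIota (ComplexShape.up ℤ)).app X.obj.as))
  naturality X Y f := by
    ext1
    obtain ⟨g, hg⟩ := (HomotopyCategory.quotient _ _).map_surjective f.hom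
    have h := (NatTrans.mapHomologicalComplex E.filIota (ComplexShape.up ℤ)).naturality g
    have h' := (HomotopyCategory.quotient E.Fil (ComplexShape.up ℤ)).congr_map h
    rw [Functor.map_comp, Functor.map_comp] at h'
    exact (congr_arg (· ≫ _) hg.symm).trans (h'.trans (congr_arg (_ ≫ ·)
      (congr_arg (E.filShift.mapHomotopyCategory (ComplexShape.up ℤ)).map hg)))

/-- The natural transformation `ι : id ⟶ s` of functors on `DF(A)`, given by the identity on
the underlying complexes. -/
def iotaDF : 𝟭 E.DF ⟶ E.shiftDF :=
  letI : Localization.Lifting E.QF E.filteredAcyclic.trW (E.shiftKF ⋙ E.QF) E.shiftDF :=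
    ⟨E.QFCompShiftDF.symm⟩
  Localization.liftNatTrans E.QF E.filteredAcyclic.trW E.QF (E.shiftKF ⋙ E.QF) (𝟭 E.DF) E.shiftDF
    (Functor.whiskerRight E.iotaKF E.QF)

lemma finitelyFiltered_trivialFil (X : HomotopyCategory A (ComplexShape.up ℤ)) :
    E.finitelyFiltered ((E.trivialFil.mapHomotopyCategory (ComplexShape.up ℤ)).obj X) := by
  refine ⟨0, 1, fun i n hi => isZero_trivialSeq_obj _ (Opposite.op i)
    (not_le.2 (Int.lt_of_add_one_le hi)), fun i j n h hi => ?_⟩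
  exact isIso_trivialSeq_map _ (homOfLE h).op hi

/-- The functor which equips a complex with the trivial filtration concentrated in degree `0`,
on homotopy categories. -/
def trivialKF : HomotopyCategory A (ComplexShape.up ℤ) ⥤ E.KF :=
  E.finitelyFiltered.lift (E.trivialFil.mapHomotopyCategory (ComplexShape.up ℤ))
    E.finitelyFiltered_trivialFil

instance : E.trivialKF.CommShift ℤ := by dsimp only [trivialKF]; infer_instance

lemma isZero_quotient_obj (X : CochainComplex A ℤ) (hX : ∀ n, IsZero (X.X n)) :
    IsZero ((HomotopyCategory.quotient A (ComplexShape.up ℤ)).obj X) := by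
  rw [IsZero.iff_id_eq_zero, ← CategoryTheory.Functor.map_id, (show 𝟙 X = 0 from by
    ext n
    exact (hX n).eq_of_src _ _), Functor.map_zero]

lemma isZero_grKF_trivialKF (i : ℤ) (hi : i ≠ 0) (X : HomotopyCategory A (ComplexShape.up ℤ)) :
    IsZero ((E.grKF i).obj (E.trivialKF.obj X)) :=
  E.Q.map_isZero (isZero_quotient_obj (((E.trivialFil ⋙ E.gr i).mapHomologicalComplex _).obj X.as)
    (fun n => E.isZero_gr_trivialFil i hi (X.as.X n)))

/-- `Gr⁰` of the trivial filtration on a complex is the complex itself. -/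
def trivialKFCompGr : E.trivialKF ⋙ E.grKF 0 ≅ E.Q :=
  Functor.isoWhiskerRight
    (Functor.mapHomotopyCategoryCompIso E.trivialFilCompGr (ComplexShape.up ℤ) ≪≫
      (Quotient.natIsoLift _ (Iso.refl _) :
        (𝟭 A).mapHomotopyCategory (ComplexShape.up ℤ) ≅ 𝟭 _)) E.Q

/-- The functor given by the trivial filtration preserves (filtered) quasi-isomorphisms. -/
def trivialLocalizer : LocalizerMorphism E.acyclicThick.trW E.filteredAcyclic.trW where
  functor := E.trivialKF
  map X Y f hf := by
    refine (E.filteredAcyclic_trW_iff _).2 fun i => ?_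
    by_cases hi : i = 0
    · subst hi
      exact (NatIso.isIso_map_iff E.trivialKFCompGr f).2
        (Localization.inverts E.Q E.acyclicThick.trW f hf)
    · exact ⟨0, (E.isZero_grKF_trivialKF i hi X).eq_of_src _ _,
        (E.isZero_grKF_trivialKF i hi Y).eq_of_src _ _⟩

instance : E.trivialLocalizer.functor.CommShift ℤ := inferInstanceAs (E.trivialKF.CommShift ℤ)

/-- The functor `j : D(A) ⥤ DF(A)` given by the trivial filtration concentrated in degree `0`. -/
def trivialDF : E.D ⥤ E.DF := E.trivialLocalizer.localizedFunctor E.Q E.QF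

instance : E.trivialDF.CommShift ℤ :=
  inferInstanceAs ((E.trivialLocalizer.localizedFunctor E.Q E.QF).CommShift ℤ)

/-- The functor `j` is computed on complexes by the trivial filtration. -/
def QFCompTrivialDF : E.trivialKF ⋙ E.QF ≅ E.Q ⋙ E.trivialDF :=
  CatCommSq.iso E.trivialLocalizer.functor E.Q E.QF
    (E.trivialLocalizer.localizedFunctor E.Q E.QF)

/-- The data of the filtered derived category: `DF(A)(≤ 0)` and `DF(A)(≥ 0)` consist of the objects
`X` such that `Grⁱ X = 0` for all `i > 0`, resp. for all `i < 0`, the functor `s` is the shift of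
the filtration, and `ι` is induced by the identity on the underlying complexes. -/
def fDF : FData E.DF where
  le X := ∀ i : ℤ, 0 < i → IsZero ((E.grDF i).obj X)
  ge X := ∀ i : ℤ, i < 0 → IsZero ((E.grDF i).obj X)
  s := E.shiftDF
  ι := E.iotaDF

end Derived

end ExactStructure

end ExactCategories

end

/-!
The f-category axioms, and the uniqueness of the sub-f-category, are formal consequences of a few
properties of the graded pieces `Grⁱ : DF(A) ⥤ D(A)`, which are collected in
`FData.IsGradedFCategory`. Since `Grⁱ (s X) = Grⁱ⁻¹ X`, the subcategories `T(≤ n)` and `T(≥ n)` are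
defined by the vanishing of graded pieces.

The sub-f-category over `C` consists of the objects all of whose graded pieces belong to `C`
(`FData.IsGradedFCategory.gradedIn`). It contains every other candidate, because a sub-f-category
over `C` is closed under truncations and shifts of the filtration, which reduce any graded piece of
an object to an object of the heart, i.e. of `C`. Conversely, an object with graded pieces in `C` is
a finite extension of filtration shifts of objects of `j(C)` (dévissage,
`FData.prop_of_graded_pieces`), so that it belongs to every candidate
(`FData.IsGradedFCategory.eq_gradedIn`).

For `DF(A)`, the truncation triangles come from the inclusion of the subcomplex `F¹`, with the
induced filtration. The axioms about morphisms are deduced from the adjunction `j ⊣ F⁰` between the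
trivial filtration `j : D(A) ⥤ DF(A)` and the functor `F⁰ : DF(A) ⥤ D(A)`. This adjunction exists
for filtered objects of `A`, and it passes to homotopy categories and to localizations
(`ExactStructure.trivialDFAdj`). Its unit is invertible, so that `j` is fully faithful; its counit
is invertible on the objects whose graded pieces vanish in nonzero degrees. By dévissage, all
morphisms `X ⟶ K` vanish if for every `n` either `Grⁿ X = 0` or `Fⁿ K = 0`
(`ExactStructure.hom_eq_zero_of_isZero_stepDF`): for `X` with a single graded piece this is the
adjunction, up to a shift of the filtration. The orthogonality of `T(≥ 1)` and `T(≤ 0)` is a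
special case, and so is the axiom on `ι : X ⟶ s X`, by applying the criterion to the cone of `ι`,
because `Fⁿ ι` is the inclusion `Fⁿ X ⟶ Fⁿ⁻¹ X`, which is invertible if `Grⁿ⁻¹ X = 0`.

That `Fⁱ⁺¹ ⟶ Fⁱ ⟶ Grⁱ` extends to a distinguished triangle of `D(A)` rests on the fact that the
total complex of a short exact sequence of complexes over an exact category is acyclic
(`ExactStructure.isAcyclic_of_total`).
-/

noncomputable section

/-! ### Graded quadruples and dévissage -/

namespace FData

variable {T : Type*} [Category* T] [HasZeroObject T] [HasShift T ℤ] [Preadditive T]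
  [∀ n : ℤ, (shiftFunctor T n).Additive] [Pretriangulated T] {f : FData T}
  {D : Type*} [Category* D] [HasZeroObject D] [HasShift D ℤ] [Preadditive D]
  [∀ n : ℤ, (shiftFunctor D n).Additive] [Pretriangulated D]
  {G : ℤ → T ⥤ D}

variable (f G) in
/-- The quadruple `f` is graded by a family of functors `G i : T ⥤ D` (the graded pieces) if
`G i` of the shifted object `s X` is `G (i - 1)` of `X`, and if `T(≤ 0)` and `T(≥ 0)` are the
subcategories of the objects whose graded pieces vanish in degrees `> 0`, resp. `< 0`. -/
structure IsGradedBy : Prop where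
  nonempty_iso (i : ℤ) : Nonempty (f.s ⋙ G i ≅ G (i - 1))
  le_iff (X : T) : f.le X ↔ ∀ i : ℤ, 0 < i → IsZero ((G i).obj X)
  ge_iff (X : T) : f.ge X ↔ ∀ i : ℤ, i < 0 → IsZero ((G i).obj X)

lemma nonempty_powNat_comp_iso (e : T ≌ T) (d : ℤ)
    (he : ∀ i, Nonempty (e.functor ⋙ G i ≅ G (i - d))) (n : ℕ) (i : ℤ) :
    Nonempty ((e.powNat n).functor ⋙ G i ≅ G (i - n * d)) := by
  induction n generalizing i with
  | zero => exact ⟨eqToIso (by simp [Equivalence.powNat]; rfl)⟩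
  | succ n hn =>
    cases n with
    | zero => simpa using! he i
    | succ n =>
      obtain ⟨e₁⟩ := hn i
      obtain ⟨e₂⟩ := he (i - (n + 1 : ℕ) * d)
      exact ⟨Functor.isoWhiskerLeft e.functor e₁ ≪≫ e₂ ≪≫
        eqToIso (by push_cast; congr 1; ring)⟩

lemma nonempty_pow_comp_iso (e : T ≌ T) (he : ∀ i, Nonempty (e.functor ⋙ G i ≅ G (i - 1)))
    (n i : ℤ) : Nonempty ((e ^ n).functor ⋙ G i ≅ G (i - n)) := by
  obtain n | n := n
  · obtain ⟨ε⟩ := nonempty_powNat_comp_iso e 1 he n i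
    exact ⟨ε ≪≫ eqToIso (by simp)⟩
  · obtain ⟨ε⟩ := nonempty_powNat_comp_iso (G := G) e.symm (-1) (fun i => by
      obtain ⟨ε⟩ := he (i - -1)
      exact ⟨Functor.isoWhiskerLeft _ (eqToIso (by simp) ≪≫ ε.symm) ≪≫
        (Functor.associator _ _ _).symm ≪≫
        Functor.isoWhiskerRight e.counitIso _ ≪≫ Functor.leftUnitor _⟩) (n + 1) i
    exact ⟨ε ≪≫ eqToIso (by simp [Int.negSucc_eq])⟩

lemma nonempty_pow_inverse_obj_iso (e : T ≌ T)
    (he : ∀ i, Nonempty (e.functor ⋙ G i ≅ G (i - 1))) (n i j : ℤ) (hij : i + n = j) (X : T) :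
    Nonempty ((G i).obj ((e ^ n).inverse.obj X) ≅ (G j).obj X) := by
  obtain rfl : i = j - n := by lia
  exact ⟨((nonempty_pow_comp_iso e he n j).some.app _).symm ≪≫
    (G j).mapIso ((e ^ n).counitIso.app X)⟩

namespace IsGradedBy

variable (hG : f.IsGradedBy G) [f.s.IsEquivalence]

include hG

lemma nonempty_pow_comp_iso (n i : ℤ) :
    Nonempty ((f.s.asEquivalence ^ n).functor ⋙ G i ≅ G (i - n)) :=
  FData.nonempty_pow_comp_iso f.s.asEquivalence hG.nonempty_iso n i

lemma isZero_pow_obj_iff (n i : ℤ) (X : T) :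
    IsZero ((G i).obj ((f.s.asEquivalence ^ n).functor.obj X)) ↔ IsZero ((G (i - n)).obj X) :=
  ((hG.nonempty_pow_comp_iso n i).some.app X).isZero_iff

lemma nonempty_inverse_obj_iso (n i j : ℤ) (hij : i + n = j) (X : T) :
    Nonempty ((G i).obj ((f.s.asEquivalence ^ n).inverse.obj X) ≅ (G j).obj X) :=
  nonempty_pow_inverse_obj_iso f.s.asEquivalence hG.nonempty_iso n i j hij X

lemma nonempty_sInv_obj_iso (i : ℤ) (X : T) :
    Nonempty ((G i).obj (f.sInv.obj X) ≅ (G (i + 1)).obj X) :=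
  hG.nonempty_inverse_obj_iso 1 i (i + 1) rfl X

lemma isZero_inverse_obj_iff (n i : ℤ) (X : T) :
    IsZero ((G i).obj ((f.s.asEquivalence ^ n).inverse.obj X)) ↔ IsZero ((G (i + n)).obj X) :=
  (hG.nonempty_inverse_obj_iso n i _ rfl X).some.isZero_iff

lemma leAt_iff (n : ℤ) (X : T) :
    f.leAt n X ↔ ∀ i : ℤ, n < i → IsZero ((G i).obj X) := by
  refine ⟨?_, fun h => ?_⟩
  · rintro ⟨Y, hY, ⟨e⟩⟩ i hi
    exact IsZero.of_iso ((hG.isZero_pow_obj_iff n i Y).2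
      ((hG.le_iff Y).1 hY _ (by lia))) ((G i).mapIso e.symm)
  · refine ⟨(f.s.asEquivalence ^ n).inverse.obj X, (hG.le_iff _).2 fun i hi => ?_,
      ⟨(f.s.asEquivalence ^ n).counitIso.app X⟩⟩
    exact (hG.isZero_inverse_obj_iff n i X).2 (h _ (by lia))

lemma geAt_iff (n : ℤ) (X : T) :
    f.geAt n X ↔ ∀ i : ℤ, i < n → IsZero ((G i).obj X) := by
  refine ⟨?_, fun h => ?_⟩
  · rintro ⟨Y, hY, ⟨e⟩⟩ i hi
    exact IsZero.of_iso ((hG.isZero_pow_obj_iff n i Y).2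
      ((hG.ge_iff Y).1 hY _ (by lia))) ((G i).mapIso e.symm)
  · refine ⟨(f.s.asEquivalence ^ n).inverse.obj X, (hG.ge_iff _).2 fun i hi => ?_,
      ⟨(f.s.asEquivalence ^ n).counitIso.app X⟩⟩
    exact (hG.isZero_inverse_obj_iff n i X).2 (h _ (by lia))

end IsGradedBy

section

variable [∀ i, (G i).CommShift ℤ] [∀ i, (G i).IsTriangulated]

variable (G) in
/-- `X` admits a truncation triangle `A ⟶ X ⟶ B ⟶ A⟦1⟧` in which the graded pieces of `A` are
in degrees `> n` and those of `B` in degrees `≤ n`. -/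
def HasTruncation (n : ℤ) (X : T) : Prop :=
  ∃ (A B : T) (a : A ⟶ X) (b : X ⟶ B) (c : B ⟶ A⟦(1 : ℤ)⟧),
    Triangle.mk a b c ∈ distTriang T ∧ (∀ i ≤ n, IsZero ((G i).obj A)) ∧
      ∀ i, n < i → IsZero ((G i).obj B)

lemma hasTruncation_of_isIso {n : ℤ} {A X : T} (a : A ⟶ X)
    (hA : ∀ i ≤ n, IsZero ((G i).obj A)) (ha : ∀ i, n < i → IsIso ((G i).map a)) :
    HasTruncation G n X := by
  obtain ⟨B, b, c, h⟩ := distinguished_cocone_triangle a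
  exact ⟨A, B, a, b, c, h, hA, fun i hi =>
    Triangle.isZero₃_of_isIso₁ _ ((G i).map_distinguished _ h) (ha i hi)⟩

lemma isIso_map_mor₁ (F : T ⥤ D) [F.CommShift ℤ] [F.IsTriangulated] {A X B : T} {a : A ⟶ X}
    {b : X ⟶ B} {c : B ⟶ A⟦(1 : ℤ)⟧} (h : Triangle.mk a b c ∈ distTriang T)
    (hB : IsZero (F.obj B)) : IsIso (F.map a) :=
  (Triangle.isZero₃_iff_isIso₁ _ (F.map_distinguished _ h)).1 hB

lemma isIso_map_mor₂ (F : T ⥤ D) [F.CommShift ℤ] [F.IsTriangulated] {A X B : T} {a : A ⟶ X}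
    {b : X ⟶ B} {c : B ⟶ A⟦(1 : ℤ)⟧} (h : Triangle.mk a b c ∈ distTriang T)
    (hA : IsZero (F.obj A)) : IsIso (F.map b) :=
  (Triangle.isZero₁_iff_isIso₂ _ (F.map_distinguished _ h)).1 hA

lemma IsGradedBy.hasTruncation [f.s.IsEquivalence] (hG : f.IsGradedBy G)
    (h₀ : ∀ X, HasTruncation G 0 X) (n : ℤ) (X : T) : HasTruncation G n X := by
  obtain ⟨A, B, a, b, c, hT, hA, hB⟩ := h₀ ((f.s.asEquivalence ^ n).inverse.obj X)
  refine hasTruncation_of_isIso ((f.s.asEquivalence ^ n).functor.map a ≫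
    (f.s.asEquivalence ^ n).counitIso.hom.app X)
    (fun i hi => (hG.isZero_pow_obj_iff n i A).2 (hA _ (by lia))) (fun i hi => ?_)
  have := isIso_map_mor₁ (G (i - n)) hT (hB _ (by lia))
  have : IsIso ((G i).map ((f.s.asEquivalence ^ n).functor.map a)) :=
    (NatIso.isIso_map_iff (hG.nonempty_pow_comp_iso n i).some a).2 this
  rw [Functor.map_comp]
  infer_instance

/-- Dévissage: an object whose graded pieces are bounded belongs to any class of objects which is
closed under extensions and contains the objects with a single graded piece, which agrees with
that of the given object. -/
lemma prop_of_graded_pieces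
    (htr : ∀ n X, HasTruncation G n X) (h₀ : ∀ X, (∀ i, IsZero ((G i).obj X)) → IsZero X)
    (S : ObjectProperty T) [S.IsClosedUnderIsomorphisms] [S.IsTriangulatedClosed₂]
    [S.ContainsZero] {a b : ℤ} {Y : T} (hY₁ : ∀ i < a, IsZero ((G i).obj Y))
    (hY₂ : ∀ i, b < i → IsZero ((G i).obj Y))
    (hS : ∀ (n : ℤ) (B : T), n ≤ b → (∀ i ≠ n, IsZero ((G i).obj B)) →
      Nonempty ((G n).obj B ≅ (G n).obj Y) → S B) : S Y := by
  by_cases! hab : b < a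
  · exact S.prop_of_isZero (h₀ _ fun i => (lt_or_ge i a).elim (hY₁ i) fun hi => hY₂ i (by lia))
  obtain ⟨k, hk⟩ : ∃ k : ℕ, a + k = b + 1 := ⟨(b + 1 - a).toNat, by lia⟩
  clear hab
  induction k generalizing a Y with
  | zero =>
    exact S.prop_of_isZero (h₀ _ fun i =>
      (lt_or_ge i a).elim (hY₁ i) fun hi => hY₂ i (by lia))
  | succ k hk' =>
    obtain ⟨A, B, α, β, γ, hT, hA, hB⟩ := htr a Y
    have isoA (i) (hi : a < i) : IsIso ((G i).map α) := isIso_map_mor₁ (G i) hT (hB i hi)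
    have isoB (i) (hi : i ≤ a) : IsIso ((G i).map β) := isIso_map_mor₂ (G i) hT (hA i hi)
    refine S.ext_of_isTriangulatedClosed₂ _ hT ?_ ?_
    · refine hk' (a := a + 1) (Y := A) (fun i hi => hA i (by lia)) (fun i hi => ?_)
        (fun n X hn hX ⟨e⟩ => ?_) (by lia)
      · have := isoA i (by lia)
        exact (hY₂ i hi).of_iso (asIso ((G i).map α))
      · by_cases! hna : n ≤ a
        · refine S.prop_of_isZero (h₀ _ fun i => ?_)
          by_cases hi : i = n
          · subst hi
            exact (hA i hna).of_iso e
          · exact hX i hi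
        · have := isoA n hna
          exact hS n X hn hX ⟨e ≪≫ asIso ((G n).map α)⟩
    · have := isoB a le_rfl
      refine hS a B (by lia) (fun i hi => ?_) ⟨(asIso ((G a).map β)).symm⟩
      by_cases! hia : a < i
      · exact hB i hia
      · have := isoB i hia
        exact (hY₁ i (by lia)).of_iso (asIso ((G i).map β)).symm

end

end FData

/-! ### Graded f-categories and their restrictions -/

namespace FData

variable {T : Type*} [Category* T] [HasZeroObject T] [HasShift T ℤ] [Preadditive T]
  [∀ n : ℤ, (shiftFunctor T n).Additive] [Pretriangulated T] {f : FData T}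
  {D : Type*} [Category* D] [HasZeroObject D] [HasShift D ℤ] [Preadditive D]
  [∀ n : ℤ, (shiftFunctor D n).Additive] [Pretriangulated D]
  {G : ℤ → T ⥤ D} [∀ i, (G i).CommShift ℤ] [∀ i, (G i).IsTriangulated]

/-- A triangulated functor detects a triangulated subcategory: the objects which it kills. -/
lemma isTriangulated_of_forall_isZero {P : ObjectProperty T} (p : ℤ → Prop)
    (hP : ∀ X, P X ↔ ∀ i, p i → IsZero ((G i).obj X)) : P.IsTriangulated where
  exists_zero := ⟨0, isZero_zero _, (hP _).2 fun i _ => (G i).map_isZero (isZero_zero _)⟩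
  isStableUnderShiftBy n :=
    { le_shift X hX := (hP _).2 fun i hi =>
        ((shiftFunctor D n).map_isZero ((hP X).1 hX i hi)).of_iso
          (((G i).commShiftIso n).app X) }
  toIsTriangulatedClosed₂ := .mk fun Tr hT h₁ h₃ =>
    ObjectProperty.le_isoClosure _ _ ((hP _).2 fun i hi =>
      Triangle.isZero₂_of_isZero₁₃ _ ((G i).map_distinguished Tr hT) ((hP _).1 h₁ i hi)
        ((hP _).1 h₃ i hi))

lemma isClosedUnderIsomorphisms_of_forall_isZero {P : ObjectProperty T} (p : ℤ → Prop)
    (hP : ∀ X, P X ↔ ∀ i, p i → IsZero ((G i).obj X)) : P.IsClosedUnderIsomorphisms where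
  of_iso e hX := (hP _).2 fun i hi => ((hP _).1 hX i hi).of_iso ((G i).mapIso e.symm)

variable (f G) in
/-- A list of conditions on a graded quadruple which imply that it is an f-category, and which are
easily restricted to full subcategories. The two conditions on `ι` of `FData.IsFCategory` are
replaced with a single one, in which no quasi-inverse of `s` appears. -/
structure IsGradedFCategory : Prop extends f.IsGradedBy G where
  [isTriangulated : IsTriangulated T]
  [isEquivalence_s : f.s.IsEquivalence]
  [isTriangulated_s : f.s.IsTriangulated]
  bounded (X : T) : ∃ a b : ℤ, (∀ i < a, IsZero ((G i).obj X)) ∧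
      ∀ i, b < i → IsZero ((G i).obj X)
  iota_s (X : T) : f.ι.app (f.s.obj X) = f.s.map (f.ι.app X)
  hom_eq_zero {X Y : T} (hX : ∀ i ≤ 0, IsZero ((G i).obj X))
    (hY : ∀ i, 0 < i → IsZero ((G i).obj Y)) (φ : X ⟶ Y) : φ = 0
  bijective {X Y : T} (hX : ∀ i < 0, IsZero ((G i).obj X))
    (hY : ∀ i, 0 < i → IsZero ((G i).obj Y)) :
      Function.Bijective (fun φ : Y ⟶ X => φ ≫ f.ι.app X)
  truncation (X : T) : HasTruncation G 0 X

lemma IsGradedBy.hasTruncation_of_isFCategory (hG : f.IsGradedBy G) (hf : f.IsFCategory)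
    (n : ℤ) (X : T) : HasTruncation G n X := by
  have := hf.isEquivalence_s
  refine hG.hasTruncation (fun X => ?_) n X
  obtain ⟨A, B, a, b, c, h, hA, hB⟩ := hf.exists_triangle X
  exact ⟨A, B, a, b, c, h, fun i hi => (hG.geAt_iff 1 A).1 hA i (by lia), (hG.le_iff B).1 hB⟩

namespace IsGradedFCategory

variable (hG : f.IsGradedFCategory G)

include hG

lemma isZero (X : T) (hX : ∀ i, IsZero ((G i).obj X)) : IsZero X :=
  (IsZero.iff_id_eq_zero X).2 (hG.hom_eq_zero (fun i _ => hX i) (fun i _ => hX i) _)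

lemma bijective_comp_iota [f.s.IsEquivalence] {X Y : T} (hX : f.geAt 1 X) (hY : f.le Y) :
    Function.Bijective (fun φ : Y ⟶ f.sInv.obj X =>
      φ ≫ f.ι.app (f.sInv.obj X) ≫ (f.sCounit X).hom) := by
  have h := (Iso.homToEquiv (f.sCounit X) (Z := Y)).bijective.comp (hG.bijective
    (X := f.sInv.obj X) (fun i hi => ((hG.geAt_iff 1 X).1 hX (i + 1) (by lia)).of_iso
      (hG.nonempty_sInv_obj_iso i X).some) ((hG.le_iff Y).1 hY))
  convert! h using 2 with φ
  exact (assoc _ _ _).symm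

/-- The second condition on `ι` follows from the first one: the two maps correspond to each other
under the equivalence `s`, because `ι` is natural. -/
lemma bijective_iota_comp [f.s.IsEquivalence] {X Y : T} (hX : f.geAt 1 X) (hY : f.le Y) :
    Function.Bijective (fun φ : f.s.obj Y ⟶ X => f.ι.app Y ≫ φ) := by
  let e : (f.s.obj Y ⟶ X) ≃ (Y ⟶ f.sInv.obj X) :=
    f.s.asEquivalence.toAdjunction.homEquiv Y X
  have h := (hG.bijective_comp_iota hX hY).comp e.bijective
  refine (congrArg Function.Bijective (funext fun φ => ?_)).mpr h
  obtain ⟨ψ, rfl⟩ := e.symm.surjective φ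
  have h₁ : ψ ≫ f.ι.app (f.sInv.obj X) = f.ι.app Y ≫ f.s.map ψ := f.ι.naturality ψ
  have h₂ : e.symm ψ = f.s.map ψ ≫ (f.sCounit X).hom :=
    f.s.asEquivalence.toAdjunction.homEquiv_counit _ _ ψ
  rw [Function.comp_apply, Equiv.apply_symm_apply, reassoc_of% h₁, h₂]

/-- A graded quadruple with the above properties is an f-category. -/
lemma isFCategory : f.IsFCategory := by
  have := hG.isTriangulated
  have := hG.isEquivalence_s
  have := hG.isTriangulated_s
  have := isTriangulated_of_forall_isZero (G := G) _ hG.le_iff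
  have := isTriangulated_of_forall_isZero (G := G) _ hG.ge_iff
  have := isClosedUnderIsomorphisms_of_forall_isZero (G := G) _ hG.le_iff
  have := isClosedUnderIsomorphisms_of_forall_isZero (G := G) _ hG.ge_iff
  exact
    { isTriangulated := inferInstance
      isTriangulated_s := inferInstance
      le_zero_le_one := fun X hX => (hG.leAt_iff 1 X).2 fun i hi =>
        (hG.leAt_iff 0 X).1 hX i (by lia)
      ge_one_le_zero := fun X hX => (hG.geAt_iff 0 X).2 fun i hi =>
        (hG.geAt_iff 1 X).1 hX i (by lia)
      exists_leAt := fun X => by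
        obtain ⟨a, b, _, h⟩ := hG.bounded X
        exact ⟨b, (hG.leAt_iff b X).2 h⟩
      exists_geAt := fun X => by
        obtain ⟨a, b, h, _⟩ := hG.bounded X
        exact ⟨a, (hG.geAt_iff a X).2 h⟩
      iota_app := fun X => by
        have h : (f.sCounit X).hom ≫ f.ι.app X =
          f.ι.app _ ≫ f.s.map (f.sCounit X).hom := f.ι.naturality _
        rw [← hG.iota_s, ← h, Iso.inv_hom_id_assoc]
      hom_eq_zero := fun hX hY φ => hG.hom_eq_zero
        (fun i hi => (hG.geAt_iff 1 _).1 hX i (by lia)) ((hG.le_iff _).1 hY) φ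
      bijective_comp_iota := hG.bijective_comp_iota
      bijective_iota_comp := hG.bijective_iota_comp
      exists_triangle := fun X => by
        obtain ⟨A, B, a, b, c, h, hA, hB⟩ := hG.truncation X
        exact ⟨A, B, a, b, c, h, (hG.geAt_iff 1 A).2 fun i hi => hA i (by lia),
          (hG.le_iff B).2 hB⟩ }

end IsGradedFCategory

/-- The restriction of a grading to a full triangulated subcategory. -/
lemma IsGradedBy.restrict (hG : f.IsGradedBy G) (P : ObjectProperty T) [P.IsTriangulated]
    (hP : ∀ X, P X → P (f.s.obj X)) : (f.restrict P hP).IsGradedBy (fun i => P.ι ⋙ G i) where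
  nonempty_iso i := ⟨Functor.isoWhiskerLeft P.ι (hG.nonempty_iso i).some⟩
  le_iff X := hG.le_iff X.obj
  ge_iff X := hG.ge_iff X.obj

/-- A full triangulated subcategory which is stable under `s`, `s⁻¹` and truncations inherits
the conditions of `IsGradedFCategory`. -/
lemma IsGradedFCategory.restrict (hG : f.IsGradedFCategory G) (P : ObjectProperty T)
    [P.IsTriangulated] [P.IsClosedUnderIsomorphisms] (hP : ∀ X, P X → P (f.s.obj X))
    (hP' : ∀ X, P X → ∃ Y, P Y ∧ Nonempty (f.s.obj Y ≅ X))
    (htr : ∀ {A X B : T} {a : A ⟶ X} {b : X ⟶ B} {c : B ⟶ A⟦(1 : ℤ)⟧},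
      Triangle.mk a b c ∈ distTriang T → (∀ i ≤ 0, IsZero ((G i).obj A)) →
        (∀ i, 0 < i → IsZero ((G i).obj B)) → P X → P A) :
    (f.restrict P hP).IsGradedFCategory (fun i => P.ι ⋙ G i) := by
  have := hG.isTriangulated
  have := hG.isEquivalence_s
  have := hG.isTriangulated_s
  have : (f.restrict P hP).s.Faithful :=
    inferInstanceAs (P.lift (P.ι ⋙ f.s) (fun X => hP X.obj X.property)).Faithful
  have : (f.restrict P hP).s.Full :=
    inferInstanceAs (P.lift (P.ι ⋙ f.s) (fun X => hP X.obj X.property)).Full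
  have : (f.restrict P hP).s.EssSurj := ⟨fun X => by
    obtain ⟨Y, hY, ⟨e⟩⟩ := hP' X.obj X.property
    exact ⟨⟨Y, hY⟩, ⟨P.isoMk e⟩⟩⟩
  have : (f.restrict P hP).s.IsTriangulated :=
    inferInstanceAs (P.lift (P.ι ⋙ f.s) (fun X => hP X.obj X.property)).IsTriangulated
  exact
    { toIsGradedBy := hG.toIsGradedBy.restrict P hP
      isEquivalence_s := { }
      bounded := fun X => hG.bounded X.obj
      iota_s := fun X => by
        ext
        exact hG.iota_s X.obj
      hom_eq_zero := fun hX hY φ => by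
        ext
        exact hG.hom_eq_zero hX hY φ.hom
      bijective := fun {X Y} hX hY => by
        have h := hG.bijective (X := X.obj) (Y := Y.obj) hX hY
        refine ⟨fun φ ψ hφ => ?_, fun φ => ?_⟩
        · ext
          exact h.1 (P.ι.congr_map hφ)
        · obtain ⟨ψ, hψ⟩ := h.2 φ.hom
          exact ⟨ObjectProperty.homMk ψ, by ext; exact hψ⟩
      truncation := fun X => by
        obtain ⟨A, B, a, b, c, hT, hA, hB⟩ := hG.truncation X.obj
        let α : (⟨A, htr hT hA hB X.property⟩ : P.FullSubcategory) ⟶ X := ObjectProperty.homMk a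
        refine hasTruncation_of_isIso (G := fun i => P.ι ⋙ G i) α hA
          (fun i hi => ?_)
        exact isIso_map_mor₁ (G i) hT (hB i hi) }

end FData

/-! ### Sub-f-categories -/

namespace FData

variable {T : Type*} [Category* T] [HasZeroObject T] [HasShift T ℤ] [Preadditive T]
  [∀ n : ℤ, (shiftFunctor T n).Additive] [Pretriangulated T] {f : FData T}
  {D : Type*} [Category* D] [HasZeroObject D] [HasShift D ℤ] [Preadditive D]
  [∀ n : ℤ, (shiftFunctor D n).Additive] [Pretriangulated D]
  {G : ℤ → T ⥤ D} [∀ i, (G i).CommShift ℤ] [∀ i, (G i).IsTriangulated]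
  {j : D ⥤ T} [j.CommShift ℤ] [j.IsTriangulated]

/-- A full subcategory which is stable under an auto-equivalence and its inverse is stable under
all of its powers. -/
lemma prop_pow_obj (P : ObjectProperty T) (e : T ≌ T) (h₁ : ∀ X, P X → P (e.functor.obj X))
    (h₂ : ∀ X, P X → P (e.inverse.obj X)) (n : ℤ) (X : T) (hX : P X) :
    P ((e ^ n).functor.obj X) := by
  have aux (e : T ≌ T) (h : ∀ X, P X → P (e.functor.obj X)) (n : ℕ) (X : T) (hX : P X) :
      P ((e.powNat n).functor.obj X) := by
    induction n generalizing X with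
    | zero => exact hX
    | succ n hn =>
      cases n with
      | zero => exact h X hX
      | succ n => exact hn _ (h X hX)
  obtain n | n := n
  · exact aux e h₁ n X hX
  · exact aux e.symm h₂ (n + 1) X hX

namespace IsGradedFCategory

variable (hG : f.IsGradedFCategory G)

include hG

/-- A fully faithful triangulated functor whose essential image consists of the objects with a
single graded piece, in degree `0`, makes `f` an f-category over its source. -/
lemma isFCategoryOver {C : Type*} [Category* C] [HasZeroObject C] [HasShift C ℤ] [Preadditive C]
    [∀ n : ℤ, (shiftFunctor C n).Additive] [Pretriangulated C]
    {j : C ⥤ T} [j.CommShift ℤ] [j.IsTriangulated] [j.Full] [j.Faithful]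
    (hj : ∀ X i, i ≠ 0 → IsZero ((G i).obj (j.obj X)))
    (hj' : ∀ X, (∀ i ≠ 0, IsZero ((G i).obj X)) → ∃ Y, Nonempty (j.obj Y ≅ X)) :
    f.IsFCategoryOver j where
  toIsFCategory := hG.isFCategory
  mem X := ⟨(hG.le_iff _).2 fun i hi => hj X i hi.ne', (hG.ge_iff _).2 fun i hi => hj X i hi.ne⟩
  isTriangulated_lift := by
    have := hG.isFCategory.isTriangulated_le
    have := hG.isFCategory.isTriangulated_ge
    have := hG.isFCategory.isClosedUnderIsomorphisms_le
    have := hG.isFCategory.isClosedUnderIsomorphisms_ge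
    infer_instance
  isEquivalence_lift :=
    { essSurj := ⟨fun X => by
        obtain ⟨Y, ⟨e⟩⟩ := hj' X.obj (fun i hi => by
          obtain hi | hi := hi.lt_or_gt
          · exact (hG.ge_iff _).1 X.property.2 i hi
          · exact (hG.le_iff _).1 X.property.1 i hi)
        exact ⟨Y, ⟨ObjectProperty.isoMk _ e⟩⟩⟩ }

omit hG

variable (e : j ⋙ G 0 ≅ 𝟭 D)
  (hj : ∀ X i, i ≠ 0 → IsZero ((G i).obj (j.obj X)))
  (hj' : ∀ X, (∀ i ≠ 0, IsZero ((G i).obj X)) → ∃ Y, Nonempty (j.obj Y ≅ X))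

/-- The objects all of whose graded pieces belong to `C`. -/
def gradedIn (G : ℤ → T ⥤ D) (C : ObjectProperty D) : ObjectProperty T :=
  fun X => ∀ i, C.isoClosure ((G i).obj X)

instance (C : ObjectProperty D) : (gradedIn G C).IsClosedUnderIsomorphisms where
  of_iso e hX i := C.isoClosure.prop_of_iso ((G i).mapIso e) (hX i)

instance (C : ObjectProperty D) [C.IsTriangulated] : (gradedIn G C).IsTriangulated where
  exists_zero := ⟨0, isZero_zero _, fun i =>
    C.isoClosure.prop_of_isZero ((G i).map_isZero (isZero_zero _))⟩
  isStableUnderShiftBy n :=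
    { le_shift X hX i := C.isoClosure.prop_of_iso (((G i).commShiftIso n).app X).symm
        (C.isoClosure.le_shift n _ (hX i)) }
  toIsTriangulatedClosed₂ := .mk' fun Tr hT h₁ h₃ i =>
    C.isoClosure.ext_of_isTriangulatedClosed₂ _ ((G i).map_distinguished Tr hT) (h₁ i) (h₃ i)

include hG e hj hj'

lemma isSubFCategoryOver_gradedIn [j.Full] [j.Faithful] (C : ObjectProperty D)
    [C.IsTriangulated] : f.IsSubFCategoryOver j C (gradedIn G C) := by
  have := hG.isEquivalence_s
  have s_mem (X : T) (hX : gradedIn G C X) : gradedIn G C (f.s.obj X) := fun i =>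
    C.isoClosure.prop_of_iso ((hG.nonempty_iso i).some.app X).symm (hX _)
  have j_mem (X : D) (hX : C X) : gradedIn G C (j.obj X) := fun i => by
    by_cases hi : i = 0
    · subst hi
      exact ⟨X, hX, ⟨e.app X⟩⟩
    · exact C.isoClosure.prop_of_isZero (hj X i hi)
  have hR : (f.restrict (gradedIn G C) s_mem).IsGradedFCategory
      (fun i => (gradedIn G C).ι ⋙ G i) := by
    refine hG.restrict _ s_mem (fun X hX => ?_) (fun {A X B a b c} hT hA hB hX i => ?_)
    · exact ⟨f.sInv.obj X, fun i =>
        C.isoClosure.prop_of_iso (hG.nonempty_sInv_obj_iso i X).some.symm (hX _), ⟨f.sCounit X⟩⟩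
    · by_cases! hi : i ≤ 0
      · exact C.isoClosure.prop_of_isZero (hA i hi)
      · have := isIso_map_mor₁ (G i) hT (hB i hi)
        exact C.isoClosure.prop_of_iso (asIso ((G i).map a)).symm (hX i)
  exact
    { s_mem := s_mem
      j_mem := j_mem
      isFCategoryOver := by
        refine hR.isFCategoryOver (fun X i hi => hj X.obj i hi) (fun X hX => ?_)
        obtain ⟨Y, ⟨ε⟩⟩ := hj' X.obj hX
        obtain ⟨Z, hZ, ⟨ε'⟩⟩ := X.property 0
        exact ⟨⟨Z, hZ⟩, ⟨(gradedIn G C).isoMk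
          (j.mapIso (ε'.symm ≪≫ (G 0).mapIso ε.symm ≪≫ e.app Y) ≪≫ ε)⟩⟩ }

omit e hj hj' in
/-- In a sub-f-category over `C`, the graded piece `Gr⁰ X` belongs to `C`, because it is also the
graded piece of the object of the heart obtained by truncating `X` on both sides. -/
lemma isoClosure_gr_zero (e : j ⋙ G 0 ≅ 𝟭 D) (C : ObjectProperty D) [C.IsTriangulated]
    (P : ObjectProperty T) (hP : f.IsSubFCategoryOver j C P) (X : T) (hX : P X) :
    C.isoClosure ((G 0).obj X) := by
  have := hP.isTriangulated
  have hf := hP.isFCategoryOver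
  have := hf.isEquivalence_s
  have hG' := hG.toIsGradedBy.restrict P hP.s_mem
  obtain ⟨A, B, a, b, c, hT, hA, hB⟩ :=
    hG'.hasTruncation_of_isFCategory hf.toIsFCategory 0 ⟨X, hX⟩
  obtain ⟨A', B', a', b', c', hT', hA', hB'⟩ :=
    hG'.hasTruncation_of_isFCategory hf.toIsFCategory (-1) B
  have hA₀ : ((f.restrict P hP.s_mem).le ⊓ (f.restrict P hP.s_mem).ge) A' := by
    refine ⟨(hG'.le_iff _).2 fun i hi => ?_, (hG'.ge_iff _).2 fun i hi => hA' i (by lia)⟩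
    have := isIso_map_mor₁ (P.ι ⋙ G i) hT' (hB' i (by lia))
    exact (hB i hi).of_iso (asIso ((P.ι ⋙ G i).map a'))
  have := hf.isEquivalence_lift
  let Y := (((f.restrict P hP.s_mem).le ⊓ (f.restrict P hP.s_mem).ge).lift _
    hf.mem).objPreimage ⟨A', hA₀⟩
  let ε := (((f.restrict P hP.s_mem).le ⊓ (f.restrict P hP.s_mem).ge).lift _
    hf.mem).objObjPreimageIso ⟨A', hA₀⟩
  have := isIso_map_mor₁ (P.ι ⋙ G 0) hT' (hB' 0 (by lia))
  have := isIso_map_mor₂ (P.ι ⋙ G 0) hT (hA 0 le_rfl)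
  exact ⟨Y.obj, Y.property, ⟨asIso ((P.ι ⋙ G 0).map b) ≪≫
    (asIso ((P.ι ⋙ G 0).map a')).symm ≪≫
    (ObjectProperty.ι _ ⋙ P.ι ⋙ G 0).mapIso ε.symm ≪≫ e.app Y.obj⟩⟩

/-- The sub-f-category over `C` is determined by `C`: its objects have graded pieces in `C`, and
conversely the objects with this property are obtained by extensions from the filtration shifts
of the objects of `C`. -/
lemma eq_gradedIn (C : ObjectProperty D) [C.IsTriangulated] (P : ObjectProperty T)
    (hP : f.IsSubFCategoryOver j C P) : P = gradedIn G C := by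
  have := hG.isEquivalence_s
  have := hP.isTriangulated
  have := hP.isClosedUnderIsomorphisms
  have sInv_mem (X : T) (hX : P X) : P (f.sInv.obj X) := by
    have := hP.isFCategoryOver.isEquivalence_s
    let ε := (f.restrict P hP.s_mem).s.objObjPreimageIso ⟨X, hX⟩
    exact P.prop_of_iso (f.s.asEquivalence.unitIso.app _ ≪≫ f.sInv.mapIso (P.ι.mapIso ε))
      (ObjectProperty.FullSubcategory.property _)
  have pow_mem := prop_pow_obj P f.s.asEquivalence hP.s_mem sInv_mem
  refine le_antisymm (fun X hX i => ?_) (fun X hX => ?_)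
  · exact C.isoClosure.prop_of_iso ((hG.nonempty_pow_comp_iso (-i) 0).some.app X ≪≫
      (eqToIso (by simp) : G (0 - -i) ≅ G i).app X)
      (hG.isoClosure_gr_zero e C P hP _ (pow_mem (-i) X hX))
  · obtain ⟨a, b, ha, hb⟩ := hG.bounded X
    refine prop_of_graded_pieces (hG.hasTruncation hG.truncation) hG.isZero P ha hb
      (fun n B _ hB ⟨ε⟩ => ?_)
    obtain ⟨Y, ⟨ε'⟩⟩ := hj' ((f.s.asEquivalence ^ n).inverse.obj B) (fun i hi =>
      (hG.isZero_inverse_obj_iff n i B).2 (hB _ (by lia)))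
    obtain ⟨Z, hZ, ⟨ε''⟩⟩ := hX n
    have ι : Y ≅ Z := (e.app Y).symm ≪≫ (G 0).mapIso ε' ≪≫
      (hG.nonempty_inverse_obj_iso n 0 n (by lia) B).some ≪≫ ε ≪≫ ε''
    exact P.prop_of_iso ((f.s.asEquivalence ^ n).functor.mapIso (j.mapIso ι.symm ≪≫ ε') ≪≫
      (f.s.asEquivalence ^ n).counitIso.app B) (pow_mem n _ (hP.j_mem Z hZ))

end IsGradedFCategory

end FData

/-! ### Short exact sequences of complexes -/

namespace ExactStructure

variable {A : Type u} [Category.{v} A] [Preadditive A] (E : ExactStructure A)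

lemma conflation_of_isLimit {X Y Z : A} {i : X ⟶ Y} {p : Y ⟶ Z} (w : i ≫ p = 0)
    (hi : IsLimit (KernelFork.ofι i w)) (hp : admissibleEpi E.conflation p) :
    E.conflation (ShortComplex.mk i p w) := by
  obtain ⟨K, k, wk, hk⟩ := hp
  let e : K ≅ X := (E.isKernel hk).some.conePointUniqueUpToIso hi
  refine E.of_iso (S := ShortComplex.mk k p wk)
    (ShortComplex.isoMk e (Iso.refl _) (Iso.refl _) ?_ ?_) hk
  · simpa using! (E.isKernel hk).some.conePointUniqueUpToIso_hom_comp hi .zero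
  · simp

section

variable {E}
variable {S : ShortComplex A} (hS : E.conflation S)

include hS

lemma mono_of_conflation : Mono S.f :=
  ⟨fun _ _ h => Fork.IsLimit.hom_ext (E.isKernel hS).some h⟩

lemma exists_lift_of_conflation {W : A} (k : W ⟶ S.X₂) (hk : k ≫ S.g = 0) :
    ∃ l : W ⟶ S.X₁, l ≫ S.f = k :=
  ⟨_, (KernelFork.IsLimit.lift' (E.isKernel hS).some k hk).2⟩

end

/-- The total complex of a short exact sequence of complexes `0 ⟶ X ⟶ Y ⟶ Z ⟶ 0` is acyclic.
Here `C` is a complex with components `X (n + 2)`, `Y (n + 1)` and `Z n` in degree `n`. Its cycles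
in degree `n` are the fibre product of `Y (n + 1)` and `Z n` over `Z (n + 1)`. -/
lemma isAcyclic_of_total {X Y Z C : CochainComplex A ℤ} {f : X ⟶ Y} {g : Y ⟶ Z}
    (w : ∀ n, f.f n ≫ g.f n = 0) (hS : ∀ n, E.conflation (ShortComplex.mk (f.f n) (g.f n) (w n)))
    (x : ∀ n, C.X n ⟶ X.X (n + 1 + 1)) (y : ∀ n, C.X n ⟶ Y.X (n + 1)) (z : ∀ n, C.X n ⟶ Z.X n)
    (hx : ∀ n, C.d n (n + 1) ≫ x (n + 1) = x n ≫ X.d (n + 1 + 1) (n + 1 + 1 + 1))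
    (hy : ∀ n, C.d n (n + 1) ≫ y (n + 1) =
      - x n ≫ f.f (n + 1 + 1) - y n ≫ Y.d (n + 1) (n + 1 + 1))
    (hz : ∀ n, C.d n (n + 1) ≫ z (n + 1) = y n ≫ g.f (n + 1) + z n ≫ Z.d n (n + 1))
    (hlift : ∀ n {W : A} (a : W ⟶ X.X (n + 1 + 1)) (b : W ⟶ Y.X (n + 1)) (c : W ⟶ Z.X n),
      ∃ l : W ⟶ C.X n, l ≫ x n = a ∧ l ≫ y n = b ∧ l ≫ z n = c)
    (hext : ∀ n {W : A} (l l' : W ⟶ C.X n), l ≫ x n = l' ≫ x n → l ≫ y n = l' ≫ y n →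
      l ≫ z n = l' ≫ z n → l = l') : E.IsAcyclic C := by
  have hmono (n) : Mono (f.f n) := mono_of_conflation (hS n)
  have hepi (n) : admissibleEpi E.conflation (g.f n) := ⟨_, _, _, hS n⟩
  choose P a b hP hb using fun n => E.epi_baseChange (g.f (n + 1)) (Z.d n (n + 1)) (hepi (n + 1))
  choose ξ hξ using fun n => exists_lift_of_conflation (hS (n + 1 + 1))
    (a n ≫ Y.d (n + 1) (n + 1 + 1)) (by
      change (a n ≫ Y.d (n + 1) (n + 1 + 1)) ≫ g.f (n + 1 + 1) = 0
      rw [assoc, ← g.comm, ← assoc, (hP n).w, assoc, Z.d_comp_d, comp_zero])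
  dsimp at hξ
  choose m hmx hmy hmz using fun n => hlift n (ξ n) (- a n) (b n)
  choose e hea heb using fun n => (hP (n + 1)).exists_lift
    (x n ≫ f.f (n + 1 + 1) + y n ≫ Y.d (n + 1) (n + 1 + 1))
    (y n ≫ g.f (n + 1) + z n ≫ Z.d n (n + 1)) (by simp [w])
  have me (n) : m n ≫ e n = 0 := by
    apply (hP (n + 1)).hom_ext
    · simp [hea, reassoc_of% hmx, reassoc_of% hmy, hξ]
    · simp [heb, reassoc_of% hmy, reassoc_of% hmz, (hP n).w]
  have hm (n) : Nonempty (IsLimit (KernelFork.ofι (m n) (me n))) := by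
    have hmn : Mono (m n) := ⟨fun k k' h => by
      apply (hP n).hom_ext
      · simpa [hmy] using h =≫ y n
      · simpa [hmz] using h =≫ z n⟩
    refine ⟨KernelFork.IsLimit.ofι' _ _ (fun {W} k hk => ?_)⟩
    have h₁ : k ≫ x n ≫ f.f (n + 1 + 1) + k ≫ y n ≫ Y.d (n + 1) (n + 1 + 1) = 0 := by
      simpa [hea] using hk =≫ a (n + 1)
    have h₂ : k ≫ y n ≫ g.f (n + 1) + k ≫ z n ≫ Z.d n (n + 1) = 0 := by
      simpa [heb] using hk =≫ b (n + 1)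
    have h₃ : (-(k ≫ y n)) ≫ g.f (n + 1) = (k ≫ z n) ≫ Z.d n (n + 1) := by
      simpa using (eq_neg_of_add_eq_zero_right h₂).symm
    refine ⟨(hP n).lift _ _ h₃, hext n _ _ ?_ ?_ ?_⟩
    · rw [← cancel_mono (f.f _)]
      simpa [hmx, hξ] using (eq_neg_of_add_eq_zero_left h₁).symm
    · simp [hmy]
    · simp [hmz]
  refine ⟨P, m, e, me, fun n => ?_, fun n => ?_⟩
  · apply hext
    · rw [← cancel_mono (f.f _)]
      simp [hx, hmx, hξ, reassoc_of% hea]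
    · simp [hy, hmy, hea]
      abel
    · simp [hz, hmz, heb]
  · -- `e n` is an admissible epimorphism, because it has a kernel, and because the base change
    -- along `b` of the admissible epimorphism `g` factors through it
    obtain ⟨W, k, p, sq, hp⟩ := E.epi_baseChange (g.f (n + 1)) (b (n + 1)) (hepi (n + 1))
    obtain ⟨η, hη⟩ := exists_lift_of_conflation (hS (n + 1 + 1))
      (p ≫ a (n + 1) - k ≫ Y.d (n + 1) (n + 1 + 1)) (by
        simp [(hP (n + 1)).w, ← reassoc_of% sq.w])
    obtain ⟨l, hlx, hly, hlz⟩ := hlift n η k 0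
    dsimp at hη
    have hl : l ≫ e n = p := by
      apply (hP (n + 1)).hom_ext
      · simp [hea, reassoc_of% hlx, reassoc_of% hly, hη]
      · simp [heb, reassoc_of% hly, reassoc_of% hlz, sq.w]
    exact E.conflation_of_isLimit _ (hm n).some
      (E.epi_of_comp l _ ⟨_, (hm n).some⟩ (hl.symm ▸ hp))

variable [HasZeroObject A] [HasBinaryBiproducts A]

/-- A short exact sequence of complexes induces a distinguished triangle in the derived category. -/
lemma exists_distinguished_of_conflation {X Y Z : CochainComplex A ℤ} {f : X ⟶ Y} {g : Y ⟶ Z}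
    (w : ∀ n, f.f n ≫ g.f n = 0)
    (hS : ∀ n, E.conflation (ShortComplex.mk (f.f n) (g.f n) (w n))) :
    ∃ δ, Triangle.mk (E.Q.map ((HomotopyCategory.quotient _ _).map f))
      (E.Q.map ((HomotopyCategory.quotient _ _).map g)) δ ∈ distTriang E.D := by
  let φ : CochainComplex.mappingCone f ⟶ Z := CochainComplex.mappingCone.desc f 0 g (by
    ext n
    simp [w])
  have hC : E.IsAcyclic (CochainComplex.mappingCone φ) := by
    refine E.isAcyclic_of_total w hS
      (fun n => (CochainComplex.mappingCone.fst φ).1.v n (n + 1) rfl ≫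
        (CochainComplex.mappingCone.fst f).1.v (n + 1) (n + 1 + 1) rfl)
      (fun n => (CochainComplex.mappingCone.fst φ).1.v n (n + 1) rfl ≫
        (CochainComplex.mappingCone.snd f).v (n + 1) (n + 1) (add_zero _))
      (fun n => (CochainComplex.mappingCone.snd φ).v n n (add_zero _))
      (fun n => ?_) (fun n => ?_) (fun n => ?_) (fun n {W} a b c => ?_)
      (fun n {W} l l' h₁ h₂ h₃ => ?_)
    · rw [reassoc_of% CochainComplex.mappingCone.d_fst_v φ n (n + 1) (n + 1 + 1) rfl rfl,
        Preadditive.neg_comp, assoc,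
        CochainComplex.mappingCone.d_fst_v f (n + 1) (n + 1 + 1) (n + 1 + 1 + 1) rfl rfl]
      simp
    · rw [reassoc_of% CochainComplex.mappingCone.d_fst_v φ n (n + 1) (n + 1 + 1) rfl rfl,
        Preadditive.neg_comp, assoc,
        CochainComplex.mappingCone.d_snd_v f (n + 1) (n + 1 + 1) rfl]
      simp
      abel
    · rw [CochainComplex.mappingCone.d_snd_v φ n (n + 1) rfl]
      simp [φ, CochainComplex.mappingCone.desc_f f 0 g _ (n + 1) (n + 1 + 1) rfl]
    · refine ⟨(a ≫ (CochainComplex.mappingCone.inl f).v (n + 1 + 1) (n + 1) (by lia) +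
        b ≫ (CochainComplex.mappingCone.inr f).f (n + 1)) ≫
          (CochainComplex.mappingCone.inl φ).v (n + 1) n (by lia) +
        c ≫ (CochainComplex.mappingCone.inr φ).f n, ?_, ?_, ?_⟩ <;> simp
    · exact CochainComplex.mappingCone.ext_to φ n (n + 1) rfl
        (CochainComplex.mappingCone.ext_to f (n + 1) (n + 1 + 1) rfl
          (by simpa using h₁) (by simpa using h₂)) h₃
  have hφ : IsIso (E.Q.map ((HomotopyCategory.quotient _ _).map φ)) := by
    refine Localization.inverts E.Q E.acyclicThick.trW _ (ObjectProperty.trW.mk _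
      (HomotopyCategory.mappingCone_triangleh_distinguished φ) ?_)
    exact E.acyclic.le_triangEnvelope _ hC
  have hT := E.Q.map_distinguished _ (HomotopyCategory.mappingCone_triangleh_distinguished f)
  let e := asIso (E.Q.map ((HomotopyCategory.quotient _ _).map φ))
  refine ⟨e.inv ≫ (E.Q.mapTriangle.obj (CochainComplex.mappingCone.triangleh f)).mor₃,
    isomorphic_distinguished _ hT _ (Triangle.isoMk _ _ (Iso.refl _) (Iso.refl _) e.symm ?_ ?_ ?_)⟩
  · exact (comp_id _).trans (id_comp _).symm
  · refine ((Iso.comp_inv_eq e).2 ?_).trans (id_comp _).symm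
    have hg : CochainComplex.mappingCone.inr f ≫ φ = g := by simp [φ]
    exact ((E.Q.map_comp _ _).symm.trans (congrArg E.Q.map
      (((HomotopyCategory.quotient _ _).map_comp _ _).symm.trans
        (congrArg (HomotopyCategory.quotient _ _).map hg)))).symm
  · exact (congrArg (_ ≫ ·) (CategoryTheory.Functor.map_id _ _)).trans (comp_id _)

end ExactStructure

/-! ### The steps of the filtration -/

namespace ExactStructure

variable {A : Type u} [Category.{v} A] [Preadditive A] (E : ExactStructure A)

lemma conflation_of_isColimit {X Y Z : A} {i : X ⟶ Y} {p : Y ⟶ Z} (w : i ≫ p = 0)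
    (hp : IsColimit (CokernelCofork.ofπ p w)) (hi : admissibleMono E.conflation i) :
    E.conflation (ShortComplex.mk i p w) := by
  obtain ⟨K, k, wk, hk⟩ := hi
  let e : K ≅ Z := (E.isCokernel hk).some.coconePointUniqueUpToIso hp
  refine E.of_iso (S := ShortComplex.mk i k wk)
    (ShortComplex.isoMk (Iso.refl _) (Iso.refl _) e ?_ ?_) hk
  · simp
  · simpa using! ((E.isCokernel hk).some.comp_coconePointUniqueUpToIso_hom hp .one).symm

lemma conflation_gr (i : ℤ) (F : E.Fil) :
    E.conflation (ShortComplex.mk ((E.filTrans (i + 1) i (by lia)).app F) ((E.grπ i).app F)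
      (E.filTrans_grπ i (i + 1) rfl F)) :=
  E.conflation_of_isColimit _ (cokernelIsCokernel _) (E.inflation_filTrans _ _ _ F)

variable [HasZeroObject A] [HasBinaryBiproducts A]

/-- The functor which sends a finitely filtered complex to its step `Fⁱ`, in the homotopy
category. -/
def stepK (i : ℤ) : E.KF ⥤ HomotopyCategory A (ComplexShape.up ℤ) :=
  E.finitelyFiltered.ι ⋙ (E.filStep i).mapHomotopyCategory (ComplexShape.up ℤ)

instance (i : ℤ) : (E.stepK i).CommShift ℤ := by dsimp only [stepK]; infer_instance

instance (i : ℤ) : (E.stepK i).IsTriangulated := by dsimp only [stepK]; infer_instance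

/-- The functor which sends a finitely filtered complex to the class in `D(A)` of its step `Fⁱ`. -/
def stepKF (i : ℤ) : E.KF ⥤ E.D := E.stepK i ⋙ E.Q

instance (i : ℤ) : (E.stepKF i).CommShift ℤ := by dsimp only [stepKF]; infer_instance

instance (i : ℤ) : (E.stepKF i).IsTriangulated := by dsimp only [stepKF]; infer_instance

/-- The transition morphisms `Fⁱ⁺¹ ⟶ Fⁱ` in `D(A)`. -/
def stepTrans (i : ℤ) : E.stepKF (i + 1) ⟶ E.stepKF i :=
  Functor.whiskerRight (Functor.whiskerLeft E.finitelyFiltered.ι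
    (NatTrans.mapHomotopyCategory (E.filTrans (i + 1) i (by lia)) (ComplexShape.up ℤ))) E.Q

lemma exists_distinguished_step (i : ℤ) (X : E.KF) :
    ∃ (β : (E.stepKF i).obj X ⟶ (E.grKF i).obj X) (δ : _),
      Triangle.mk ((E.stepTrans i).app X) β δ ∈ distTriang E.D :=
  ⟨_, E.exists_distinguished_of_conflation
    (f := (NatTrans.mapHomologicalComplex (E.filTrans (i + 1) i (by lia)) _).app X.obj.as)
    (g := (NatTrans.mapHomologicalComplex (E.grπ i) _).app X.obj.as)
    (fun n => E.filTrans_grπ i (i + 1) rfl (X.obj.as.X n))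
    (fun n => E.conflation_gr i (X.obj.as.X n))⟩

lemma isIso_stepTrans_iff (i : ℤ) (X : E.KF) :
    IsIso ((E.stepTrans i).app X) ↔ IsZero ((E.grKF i).obj X) := by
  obtain ⟨β, δ, h⟩ := E.exists_distinguished_step i X
  exact (Triangle.isZero₃_iff_isIso₁ _ h).symm

lemma isZero_grKF_of_isZero_stepKF (i : ℤ) (X : E.KF) (h₁ : IsZero ((E.stepKF (i + 1)).obj X))
    (h₂ : IsZero ((E.stepKF i).obj X)) : IsZero ((E.grKF i).obj X) := by
  obtain ⟨β, δ, h⟩ := E.exists_distinguished_step i X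
  exact Triangle.isZero₃_of_isZero₁₂ _ h h₁ h₂

lemma isZero_stepKF_of_isZero_grKF (n : ℤ) (X : E.KF)
    (hX : ∀ i, n ≤ i → IsZero ((E.grKF i).obj X)) : IsZero ((E.stepKF n).obj X) := by
  obtain ⟨a, b, hb, _⟩ := X.property
  have h (k : ℕ) (m : ℤ) (hm : b ≤ m + k) (hnm : n ≤ m) : IsZero ((E.stepKF m).obj X) := by
    induction k generalizing m with
    | zero => exact E.Q.map_isZero (isZero_quotient_obj
        (((E.filStep m).mapHomologicalComplex _).obj X.obj.as)
        (fun p => hb m p (by simpa using hm)))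
    | succ k hk =>
      have := (E.isIso_stepTrans_iff m X).2 (hX m hnm)
      exact (hk (m + 1) (by push_cast at hm; lia) (by lia)).of_iso
        (asIso ((E.stepTrans m).app X)).symm
  exact h (b - n).toNat n (by lia) le_rfl

lemma isIso_stepKF_map (i : ℤ) {X Y : E.KF} (f : X ⟶ Y) (hf : E.filteredAcyclic.trW f) :
    IsIso ((E.stepKF i).map f) := by
  obtain ⟨Z, g, h, hT, hZ⟩ := hf
  exact (Triangle.isZero₃_iff_isIso₁ _ ((E.stepKF i).map_distinguished _ hT)).1
    (E.isZero_stepKF_of_isZero_grKF i Z (fun j _ => hZ j))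

/-- The functor `Fⁱ : DF(A) ⥤ D(A)`. -/
def stepDF (i : ℤ) : E.DF ⥤ E.D :=
  Localization.lift (E.stepKF i) (fun _ _ f hf => E.isIso_stepKF_map i f hf) E.QF

instance (i : ℤ) : Localization.Lifting E.QF E.filteredAcyclic.trW (E.stepKF i) (E.stepDF i) :=
  ⟨Localization.fac _ _ _⟩

instance (i : ℤ) : Localization.Lifting E.QF E.filteredAcyclic.trW (E.grKF i) (E.grDF i) :=
  ⟨Localization.fac _ _ _⟩

instance : E.QF.EssSurj := Localization.essSurj _ E.filteredAcyclic.trW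

instance : E.QF.mapArrow.EssSurj := Localization.essSurj_mapArrow _ E.filteredAcyclic.trW

instance : E.Q.EssSurj := Localization.essSurj _ E.acyclicThick.trW

instance : E.Q.mapArrow.EssSurj := Localization.essSurj_mapArrow _ E.acyclicThick.trW

/-- A functor `DF(A) ⥤ D(A)` induced by a triangulated functor commutes with the shift. -/
abbrev commShiftOfLifting (F : E.KF ⥤ E.D) [F.CommShift ℤ] (F' : E.DF ⥤ E.D)
    [Localization.Lifting E.QF E.filteredAcyclic.trW F F'] : F'.CommShift ℤ :=
  Functor.commShiftOfLocalization E.QF E.filteredAcyclic.trW ℤ F F'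

lemma isTriangulated_of_lifting (F : E.KF ⥤ E.D) [F.CommShift ℤ] [F.IsTriangulated]
    (F' : E.DF ⥤ E.D) [Localization.Lifting E.QF E.filteredAcyclic.trW F F'] :
    letI := E.commShiftOfLifting F F'
    F'.IsTriangulated :=
  letI := E.commShiftOfLifting F F'
  have : NatTrans.CommShift (Localization.Lifting.iso E.QF E.filteredAcyclic.trW F F').hom ℤ :=
    NatTrans.commShift_iso_hom_of_localization E.QF E.filteredAcyclic.trW ℤ F F'
  Functor.isTriangulated_of_precomp_iso (Localization.Lifting.iso E.QF E.filteredAcyclic.trW F F')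

instance (i : ℤ) : (E.grDF i).CommShift ℤ := E.commShiftOfLifting (E.grKF i) _

instance (i : ℤ) : (E.grDF i).IsTriangulated := E.isTriangulated_of_lifting (E.grKF i) _

instance (i : ℤ) : (E.stepDF i).CommShift ℤ := E.commShiftOfLifting (E.stepKF i) _

instance (i : ℤ) : (E.stepDF i).IsTriangulated := E.isTriangulated_of_lifting (E.stepKF i) _

/-- The functor `Fⁱ` on `DF(A)` is computed on complexes as the `i`-th step of the filtration. -/
def QFCompStepDF (i : ℤ) : E.QF ⋙ E.stepDF i ≅ E.stepKF i :=
  Localization.Lifting.iso E.QF E.filteredAcyclic.trW _ _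

/-- The functor `Grⁱ` on `DF(A)` is computed on complexes as the `i`-th graded piece. -/
def QFCompGrDF (i : ℤ) : E.QF ⋙ E.grDF i ≅ E.grKF i :=
  Localization.Lifting.iso E.QF E.filteredAcyclic.trW _ _

instance : E.shiftKF.IsTriangulated := by dsimp only [shiftKF]; infer_instance

instance : E.trivialKF.IsTriangulated := by dsimp only [trivialKF]; infer_instance

instance : E.shiftDF.IsTriangulated := by
  have : NatTrans.CommShift E.QFCompShiftDF.hom ℤ :=
    E.shiftLocalizer.natTransCommShift_hom E.QF E.QF _ E.QFCompShiftDF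
  exact Functor.isTriangulated_of_precomp_iso E.QFCompShiftDF.symm

instance : E.trivialDF.IsTriangulated := by
  have : NatTrans.CommShift E.QFCompTrivialDF.hom ℤ :=
    E.trivialLocalizer.natTransCommShift_hom E.Q E.QF _ E.QFCompTrivialDF
  exact Functor.isTriangulated_of_precomp_iso E.QFCompTrivialDF.symm

end ExactStructure

/-! ### The shift of filtrations is an equivalence -/

namespace ExactStructure

variable {A : Type u} [Category.{v} A] [Preadditive A] (E : ExactStructure A)

/-- The functor `i ↦ i + 1` on the index category. -/
def succOp : ℤᵒᵖ ⥤ ℤᵒᵖ where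
  obj i := Opposite.op (i.unop + 1)
  map f := (homOfLE (add_le_add_left f.unop.le 1)).op

/-- The functors `i ↦ i - 1` and `i ↦ i + 1` are inverse to each other. -/
def predOpEquivalence : ℤᵒᵖ ≌ ℤᵒᵖ where
  functor := predOp
  inverse := succOp
  unitIso := NatIso.ofComponents (fun i => eqToIso (by simp [predOp, succOp]))
    (fun _ => Subsingleton.elim _ _)
  counitIso := NatIso.ofComponents (fun i => eqToIso (by simp [predOp, succOp]))
    (fun _ => Subsingleton.elim _ _)
  functor_unitIso_comp _ := Subsingleton.elim _ _

instance : ((Functor.whiskeringLeft ℤᵒᵖ ℤᵒᵖ A).obj predOp).IsEquivalence :=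
  inferInstanceAs (predOpEquivalence.symm.congrLeft (E := A)).functor.IsEquivalence

instance : E.filShift.Faithful :=
  have : (E.isFiltration.ι ⋙ (Functor.whiskeringLeft ℤᵒᵖ ℤᵒᵖ A).obj predOp).Faithful :=
    Functor.Faithful.comp _ _
  Functor.Faithful.of_comp_iso (E.isFiltration.liftCompιIso _ (fun F _ _ _ => F.property _))

instance : E.filShift.Full :=
  have : (E.isFiltration.ι ⋙ (Functor.whiskeringLeft ℤᵒᵖ ℤᵒᵖ A).obj predOp).Full :=
    Functor.Full.comp _ _
  Functor.Full.of_comp_faithful_iso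
    (E.isFiltration.liftCompιIso _ (fun F _ _ _ => F.property _))

/-- The inverse shift of filtrations `F ↦ (i ↦ Fⁱ⁺¹)`. -/
def filUnshift : E.Fil ⥤ E.Fil :=
  E.isFiltration.lift
    (E.isFiltration.ι ⋙ (Functor.whiskeringLeft ℤᵒᵖ ℤᵒᵖ A).obj succOp)
    (fun F _ _ _ => F.property _)

instance : E.filUnshift.Additive where

/-- The functor `filShift` is essentially surjective, because of `filUnshift`. -/
def filUnshiftCompFilShift : E.filUnshift ⋙ E.filShift ≅ 𝟭 E.Fil :=
  NatIso.ofComponents (fun F => ObjectProperty.isoMk _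
    (Functor.isoWhiskerRight predOpEquivalence.unitIso.symm F.obj)) (fun f => by
      ext i
      exact (f.hom.naturality (predOpEquivalence.unitInv.app i)).symm)

variable [HasZeroObject A] [HasBinaryBiproducts A]

instance : E.shiftKF.Faithful := by dsimp only [shiftKF]; infer_instance

instance : E.shiftKF.Full := by dsimp only [shiftKF]; infer_instance

instance : E.shiftKF.EssSurj := ⟨fun X => by
  obtain ⟨a, b, h₁, h₂⟩ := X.property
  refine ⟨⟨(E.filUnshift.mapHomotopyCategory (ComplexShape.up ℤ)).obj X.obj,
    a - 1, b - 1, fun i n hi => h₁ (i + 1) n (by lia),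
    fun i j n h hi => h₂ (i + 1) (j + 1) n (by lia) (by lia)⟩, ⟨ObjectProperty.isoMk _ ?_⟩⟩
  exact (Functor.mapHomotopyCategoryCompIso E.filUnshiftCompFilShift (ComplexShape.up ℤ) ≪≫
      (Quotient.natIsoLift _ (Iso.refl _) :
        (𝟭 E.Fil).mapHomotopyCategory (ComplexShape.up ℤ) ≅ 𝟭 _)).app X.obj⟩

instance : E.shiftKF.IsEquivalence where

instance : E.shiftLocalizer.IsLocalizedEquivalence := by
  have : E.shiftLocalizer.functor.IsEquivalence := inferInstanceAs E.shiftKF.IsEquivalence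
  refine .of_equivalence _ fun X Y f hf => ?_
  let eX := E.shiftKF.objObjPreimageIso X
  let eY := E.shiftKF.objObjPreimageIso Y
  refine ⟨_, _, E.shiftKF.preimage (eX.hom ≫ f ≫ eY.inv), ?_,
    ⟨Arrow.isoMk eX eY (by simp [shiftLocalizer])⟩⟩
  rw [filteredAcyclic_trW_iff] at hf ⊢
  intro k
  obtain ⟨i, rfl⟩ : ∃ i, k = i + 1 - 1 := ⟨k, by lia⟩
  rw [← NatIso.isIso_map_iff (E.shiftKFCompGr (i + 1))]
  have := hf (i + 1)
  simp
  infer_instance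

instance : E.shiftDF.IsEquivalence := E.shiftLocalizer.localizedFunctor_isEquivalence E.QF E.QF

end ExactStructure

/-! ### Truncations -/

namespace ExactStructure

variable {A : Type u} [Category.{v} A] [Preadditive A] (E : ExactStructure A)

/-- The functor `i ↦ max i 1` on the index category. -/
def maxOp : ℤᵒᵖ ⥤ ℤᵒᵖ where
  obj i := Opposite.op (max i.unop 1)
  map f := (homOfLE (max_le_max_right 1 f.unop.le)).op

/-- The subobject `F¹` of a filtered object, with the induced filtration `i ↦ F^(max i 1)`. -/
def filTrunc : E.Fil ⥤ E.Fil :=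
  E.isFiltration.lift
    (E.isFiltration.ι ⋙ (Functor.whiskeringLeft ℤᵒᵖ ℤᵒᵖ A).obj maxOp)
    (fun F _ _ _ => F.property _)

instance : E.filTrunc.Additive where

/-- The inclusion of `F¹` in `F`. -/
def filTruncι : E.filTrunc ⟶ 𝟭 E.Fil where
  app F := ObjectProperty.homMk
    { app := fun i => F.obj.map (homOfLE (le_max_left i.unop 1)).op
      naturality := fun i j f =>
        (F.obj.map_comp (maxOp.map f) _).symm.trans (F.obj.map_comp _ f) }
  naturality F G f := by
    ext i
    exact (f.hom.naturality _).symm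

lemma isIso_map_of_eq (F : ℤᵒᵖ ⥤ A) {i j : ℤᵒᵖ} (f : i ⟶ j) (h : i = j) : IsIso (F.map f) := by
  subst h
  obtain rfl : f = 𝟙 i := Subsingleton.elim _ _
  infer_instance

lemma isIso_gr_map (i : ℤ) {F G : E.Fil} (f : F ⟶ G) (h₁ : IsIso ((E.filStep i).map f))
    (h₂ : IsIso ((E.filStep (i + 1)).map f)) : IsIso ((E.gr i).map f) :=
  (cokernel.mapIso _ _ (asIso ((E.filStep (i + 1)).map f)) (asIso ((E.filStep i).map f))
    ((E.filTrans (i + 1) i (by lia)).naturality f).symm).isIso_hom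

lemma isIso_gr_filTruncι (i : ℤ) (hi : 0 < i) (F : E.Fil) :
    IsIso ((E.gr i).map (E.filTruncι.app F)) :=
  E.isIso_gr_map i _ (isIso_map_of_eq F.obj _ (congrArg Opposite.op (max_eq_left hi)))
    (isIso_map_of_eq F.obj _ (congrArg Opposite.op (max_eq_left (by lia))))

lemma isZero_gr_filTrunc (i : ℤ) (hi : i ≤ 0) (F : E.Fil) :
    IsZero ((E.gr i).obj (E.filTrunc.obj F)) := by
  have : IsIso ((E.filTrans (i + 1) i (by lia)).app (E.filTrunc.obj F)) :=
    isIso_map_of_eq F.obj _ (congrArg Opposite.op (by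
      dsimp
      rw [max_eq_right (by lia), max_eq_right (by lia)]))
  exact E.isZero_gr inferInstance

variable [HasZeroObject A] [HasBinaryBiproducts A]

lemma finitelyFiltered_filTrunc (X : HomotopyCategory E.Fil (ComplexShape.up ℤ))
    (hX : E.finitelyFiltered X) :
    E.finitelyFiltered ((E.filTrunc.mapHomotopyCategory (ComplexShape.up ℤ)).obj X) := by
  obtain ⟨a, b, h₁, h₂⟩ := hX
  exact ⟨1, b, fun i n hi => h₁ (max i 1) n (by lia),
    fun i j n h hi => isIso_map_of_eq (X.as.X n).obj _ (congrArg Opposite.op (by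
      dsimp
      rw [max_eq_right (by lia), max_eq_right (by lia)]))⟩

/-- The subcomplex `F¹` of a finitely filtered complex, with the induced filtration. -/
def truncKF (X : E.KF) : E.KF := ⟨_, E.finitelyFiltered_filTrunc X.obj X.property⟩

/-- The inclusion of the subcomplex `F¹` in a finitely filtered complex. -/
def truncKFι (X : E.KF) : E.truncKF X ⟶ X :=
  ObjectProperty.homMk ((HomotopyCategory.quotient E.Fil (ComplexShape.up ℤ)).map
    ((NatTrans.mapHomologicalComplex E.filTruncι (ComplexShape.up ℤ)).app X.obj.as))

lemma isZero_grKF_truncKF (i : ℤ) (hi : i ≤ 0) (X : E.KF) :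
    IsZero ((E.grKF i).obj (E.truncKF X)) :=
  E.Q.map_isZero (isZero_quotient_obj (((E.filTrunc ⋙ E.gr i).mapHomologicalComplex _).obj
    X.obj.as) (fun n => E.isZero_gr_filTrunc i hi (X.obj.as.X n)))

lemma isIso_grKF_truncKFι (i : ℤ) (hi : 0 < i) (X : E.KF) :
    IsIso ((E.grKF i).map (E.truncKFι X)) := by
  let φ := ((E.gr i).mapHomologicalComplex _).map
    ((NatTrans.mapHomologicalComplex E.filTruncι (ComplexShape.up ℤ)).app X.obj.as)
  have (n : ℤ) : IsIso (φ.f n) := E.isIso_gr_filTruncι i hi (X.obj.as.X n)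
  have : IsIso φ := HomologicalComplex.Hom.isIso_of_components φ
  exact inferInstanceAs (IsIso (E.Q.map ((HomotopyCategory.quotient _ _).map φ)))

/-- If the functors `F` and `F'` on `DF(A)` are induced by functors `F₀` and `F₀'` on complexes
which are related by the shift of filtrations, then so are `F` and `F'`. -/
def shiftDFCompIso {F₀ F₀' : E.KF ⥤ E.D} {F F' : E.DF ⥤ E.D} (e : E.QF ⋙ F ≅ F₀)
    (e' : E.QF ⋙ F' ≅ F₀') (ε : E.shiftKF ⋙ F₀ ≅ F₀') : E.shiftDF ⋙ F ≅ F' :=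
  letI : Localization.Lifting E.QF E.filteredAcyclic.trW (E.shiftKF ⋙ F₀) (E.shiftDF ⋙ F) :=
    ⟨(Functor.associator _ _ _).symm ≪≫ Functor.isoWhiskerRight E.QFCompShiftDF.symm F ≪≫
      Functor.associator _ _ _ ≪≫ Functor.isoWhiskerLeft _ e⟩
  letI : Localization.Lifting E.QF E.filteredAcyclic.trW F₀' F' := ⟨e'⟩
  Localization.liftNatIso E.QF E.filteredAcyclic.trW (E.shiftKF ⋙ F₀) F₀' _ _ ε

/-- `Grⁱ (sX) = Grⁱ⁻¹ X` in `D(A)`, for `X` in `DF(A)`. -/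
def shiftDFCompGrDF (i : ℤ) : E.shiftDF ⋙ E.grDF i ≅ E.grDF (i - 1) :=
  E.shiftDFCompIso (E.QFCompGrDF i) (E.QFCompGrDF (i - 1)) (E.shiftKFCompGr i)

/-- `Fⁱ (sX) = Fⁱ⁻¹ X` in `D(A)`, for `X` in `DF(A)`. -/
def shiftDFCompStepDF (i : ℤ) : E.shiftDF ⋙ E.stepDF i ≅ E.stepDF (i - 1) :=
  E.shiftDFCompIso (E.QFCompStepDF i) (E.QFCompStepDF (i - 1))
    (Functor.isoWhiskerLeft E.finitelyFiltered.ι (Functor.isoWhiskerRight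
      (Functor.mapHomotopyCategoryCompIso (H := E.filStep (i - 1)) (Iso.refl _)
        (ComplexShape.up ℤ)) E.Q))

lemma isGradedBy_grDF : E.fDF.IsGradedBy E.grDF where
  nonempty_iso i := ⟨E.shiftDFCompGrDF i⟩
  le_iff _ := Iff.rfl
  ge_iff _ := Iff.rfl

lemma isZero_grDF_QF_iff (i : ℤ) (X : E.KF) :
    IsZero ((E.grDF i).obj (E.QF.obj X)) ↔ IsZero ((E.grKF i).obj X) :=
  ((E.QFCompGrDF i).app X).isZero_iff

lemma isZero_of_isZero_grDF (X : E.DF) (hX : ∀ i, IsZero ((E.grDF i).obj X)) : IsZero X := by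
  have hX' (i : ℤ) : IsZero ((E.grKF i).obj (E.QF.objPreimage X)) :=
    (E.isZero_grDF_QF_iff i _).1 ((hX i).of_iso ((E.grDF i).mapIso (E.QF.objObjPreimageIso X)))
  have h : E.filteredAcyclic.trW (0 : E.QF.objPreimage X ⟶ 0) :=
    (E.filteredAcyclic_trW_iff _).2 fun i => ⟨0, (hX' i).eq_of_src _ _,
      ((E.grKF i).map_isZero (isZero_zero _)).eq_of_src _ _⟩
  have := Localization.inverts E.QF _ _ h
  exact (E.QF.map_isZero (isZero_zero _)).of_iso
    ((E.QF.objObjPreimageIso X).symm ≪≫ asIso (E.QF.map (0 : E.QF.objPreimage X ⟶ 0)))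

/-- The subcomplex `F¹` of a filtered complex, with the induced filtration, is its truncation. -/
lemma hasTruncation_grDF (X : E.DF) : FData.HasTruncation E.grDF 0 X := by
  let e := E.QF.objObjPreimageIso X
  refine FData.hasTruncation_of_isIso (E.QF.map (E.truncKFι (E.QF.objPreimage X)) ≫ e.hom)
    (fun i hi => (E.isZero_grDF_QF_iff i _).2 (E.isZero_grKF_truncKF i hi _)) (fun i hi => ?_)
  have : IsIso ((E.grDF i).map (E.QF.map (E.truncKFι (E.QF.objPreimage X)))) :=
    (NatIso.isIso_map_iff (E.QFCompGrDF i) _).2 (E.isIso_grKF_truncKFι i hi _)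
  rw [Functor.map_comp]
  infer_instance

lemma bounded_grDF (X : E.DF) : ∃ a b : ℤ, (∀ i < a, IsZero ((E.grDF i).obj X)) ∧
    ∀ i, b < i → IsZero ((E.grDF i).obj X) := by
  obtain ⟨a, b, h₁, h₂⟩ := (E.QF.objPreimage X).property
  have key (i : ℤ) (h : i < a ∨ b < i) : IsZero ((E.grDF i).obj X) := by
    refine ((E.isZero_grDF_QF_iff i _).2 ?_).of_iso
      ((E.grDF i).mapIso (E.QF.objObjPreimageIso X).symm)
    refine E.Q.map_isZero (isZero_quotient_obj (((E.gr i).mapHomologicalComplex _).obj _)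
      (fun n => E.isZero_gr ?_))
    obtain h | h := h
    · have := h₂ (i + 1) i n (by lia) (by lia)
      exact @IsIso.epi_of_iso _ _ _ _ _ this
    · exact ⟨fun _ _ _ => (h₁ i n h.le).eq_of_src _ _⟩
  exact ⟨a, b, fun i hi => key i (Or.inl hi), fun i hi => key i (Or.inr hi)⟩

lemma iotaDF_app_QF (X : E.KF) : E.iotaDF.app (E.QF.obj X) =
    E.QF.map (E.iotaKF.app X) ≫ E.QFCompShiftDF.hom.app X := by
  let : Localization.Lifting E.QF E.filteredAcyclic.trW (E.shiftKF ⋙ E.QF) E.shiftDF :=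
    ⟨E.QFCompShiftDF.symm⟩
  exact (Localization.liftNatTrans_app E.QF E.filteredAcyclic.trW E.QF (E.shiftKF ⋙ E.QF)
    (𝟭 E.DF) E.shiftDF _ X).trans (id_comp _)

lemma iotaKF_app_shiftKF (X : E.KF) :
    E.iotaKF.app (E.shiftKF.obj X) = E.shiftKF.map (E.iotaKF.app X) := rfl

lemma iotaDF_app_shiftDF (X : E.DF) :
    E.iotaDF.app (E.shiftDF.obj X) = E.shiftDF.map (E.iotaDF.app X) := by
  have key : Functor.whiskerLeft E.shiftDF E.iotaDF = Functor.whiskerRight E.iotaDF E.shiftDF := by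
    refine Localization.natTrans_ext E.QF E.filteredAcyclic.trW fun X => ?_
    have h₁ : E.QFCompShiftDF.hom.app X ≫ E.iotaDF.app (E.shiftDF.obj (E.QF.obj X)) =
        E.iotaDF.app (E.QF.obj (E.shiftKF.obj X)) ≫ E.shiftDF.map (E.QFCompShiftDF.hom.app X) :=
      E.iotaDF.naturality (E.QFCompShiftDF.hom.app X)
    have h₂ : E.QF.map (E.shiftKF.map (E.iotaKF.app X)) ≫
        E.QFCompShiftDF.hom.app (E.shiftKF.obj X) =
          E.QFCompShiftDF.hom.app X ≫ E.shiftDF.map (E.QF.map (E.iotaKF.app X)) :=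
      E.QFCompShiftDF.hom.naturality (E.iotaKF.app X)
    refine (cancel_epi (E.QFCompShiftDF.hom.app X)).1 (h₁.trans ?_)
    rw [iotaDF_app_QF, iotaKF_app_shiftKF, h₂, assoc, Functor.whiskerRight_app, iotaDF_app_QF]
    exact congrArg (_ ≫ ·) (E.shiftDF.map_comp _ _).symm
  exact NatTrans.congr_app key X

end ExactStructure

/-! ### The trivial filtration as a left adjoint -/

/-- The adjunction between categories of complexes which is induced by an adjunction between
additive functors. -/
def CategoryTheory.Adjunction.mapHomologicalComplex {V W : Type*} [Category* V] [Category* W]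
    [Preadditive V] [Preadditive W] {F : V ⥤ W} {G : W ⥤ V} [F.Additive] [G.Additive]
    (adj : F ⊣ G) {ι : Type*} (c : ComplexShape ι) :
    F.mapHomologicalComplex c ⊣ G.mapHomologicalComplex c :=
  Adjunction.mkOfUnitCounit
    { unit :=
        { app X :=
            { f n := adj.unit.app (X.X n)
              comm' _ _ _ := (adj.unit.naturality _).symm }
          naturality _ _ _ := by
            ext n
            exact adj.unit.naturality _ }
      counit :=
        { app X :=
            { f n := adj.counit.app (X.X n)
              comm' _ _ _ := (adj.counit.naturality _).symm }
          naturality _ _ _ := by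
            ext n
            exact adj.counit.naturality _ }
      left_triangle := by
        ext X n
        exact (congrArg (_ ≫ ·) (id_comp _)).trans (adj.left_triangle_components (X.X n))
      right_triangle := by
        ext X n
        exact (congrArg (_ ≫ ·) (id_comp _)).trans (adj.right_triangle_components (X.X n)) }

/-- The adjunction between homotopy categories which is induced by an adjunction between additive
functors. -/
def CategoryTheory.Adjunction.mapHomotopyCategory {V W : Type*} [Category* V] [Category* W]
    [Preadditive V] [Preadditive W] {F : V ⥤ W} {G : W ⥤ V} [F.Additive] [G.Additive]
    (adj : F ⊣ G) {ι : Type*} (c : ComplexShape ι) :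
    F.mapHomotopyCategory c ⊣ G.mapHomotopyCategory c :=
  Adjunction.mkOfUnitCounit
    { unit := Quotient.natTransLift _
        (Functor.whiskerRight (adj.mapHomologicalComplex c).unit (HomotopyCategory.quotient V c))
      counit := Quotient.natTransLift _
        (Functor.whiskerRight (adj.mapHomologicalComplex c).counit (HomotopyCategory.quotient W c))
      left_triangle := by
        ext X
        obtain ⟨X, rfl⟩ := X.quotient_obj_surjective
        have := (HomotopyCategory.quotient W c).congr_map
          ((adj.mapHomologicalComplex c).left_triangle_components X)
        rw [Functor.map_comp, Functor.map_id] at this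
        exact (congrArg (_ ≫ ·) (id_comp _)).trans this
      right_triangle := by
        ext X
        obtain ⟨X, rfl⟩ := X.quotient_obj_surjective
        have := (HomotopyCategory.quotient V c).congr_map
          ((adj.mapHomologicalComplex c).right_triangle_components X)
        rw [Functor.map_comp, Functor.map_id] at this
        exact (congrArg (_ ≫ ·) (id_comp _)).trans this }

namespace ExactStructure

variable {A : Type u} [Category.{v} A] [Preadditive A] (E : ExactStructure A) [HasZeroObject A]

/-- The morphism from the trivial filtration on `X` to `F` which is given by `X ⟶ F⁰`. -/
def trivialSeqHom {X : A} (F : ℤᵒᵖ ⥤ A) (g : X ⟶ F.obj (Opposite.op 0)) : trivialSeq X ⟶ F where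
  app i := if hi : i.unop ≤ 0 then (trivialSeqObjIso X i hi).hom ≫ g ≫
    F.map (homOfLE hi).op else 0
  naturality i j f := by
    by_cases hi : i.unop ≤ 0
    · have hj : j.unop ≤ 0 := f.unop.le.trans hi
      rw [dif_pos hi, dif_pos hj, assoc, assoc, ← F.map_comp, ← trivialSeq_map_comp X f hi hj,
        assoc]
      rfl
    · exact (isZero_trivialSeq_obj _ i hi).eq_of_src _ _

lemma trivialSeqHom_app {X : A} (F : ℤᵒᵖ ⥤ A) (g : X ⟶ F.obj (Opposite.op 0)) (i : ℤᵒᵖ)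
    (hi : i.unop ≤ 0) : (trivialSeqHom F g).app i =
      (trivialSeqObjIso X i hi).hom ≫ g ≫ F.map (homOfLE hi).op :=
  dif_pos hi

/-- The morphisms from the trivial filtration on `X` to `F` are the morphisms `X ⟶ F⁰`. -/
def trivialSeqHomEquiv (X : A) (F : ℤᵒᵖ ⥤ A) :
    (trivialSeq X ⟶ F) ≃ (X ⟶ F.obj (Opposite.op 0)) where
  toFun f := (trivialSeqObjIso X (Opposite.op 0) le_rfl).inv ≫ f.app (Opposite.op 0)
  invFun g := trivialSeqHom F g
  left_inv f := by
    ext i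
    by_cases hi : i.unop ≤ 0
    · have h : (trivialSeqObjIso X (Opposite.op 0) le_rfl).inv ≫
          (trivialSeq X).map (Y := i) (homOfLE hi).op = (trivialSeqObjIso X i hi).inv := by
        rw [Iso.inv_comp_eq, Iso.eq_comp_inv]
        exact trivialSeq_map_comp X _ le_rfl hi
      rw [trivialSeqHom_app _ _ _ hi, assoc]
      refine (congrArg (fun x => _ ≫ _ ≫ x) (f.naturality (Y := i) (homOfLE hi).op).symm).trans ?_
      rw [reassoc_of% h, Iso.hom_inv_id_assoc]
    · exact (isZero_trivialSeq_obj _ i hi).eq_of_src _ _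
  right_inv g := by
    refine (congrArg (_ ≫ ·) (trivialSeqHom_app _ _ _ le_rfl)).trans
      ((Iso.inv_hom_id_assoc _ _).trans ?_)
    exact (congrArg (g ≫ ·) (F.map_id _)).trans (comp_id g)

/-- The functor `Fil ⥤ A` which sends a filtration to `F⁰` is right adjoint to the functor which
equips an object with the trivial filtration concentrated in degree `0`. -/
def trivialFilAdj : E.trivialFil ⊣ E.filStep 0 :=
  Adjunction.mkOfHomEquiv
    { homEquiv X F := (E.isFiltration.fullyFaithfulι.homEquiv
        (X := E.trivialFil.obj X)).trans (trivialSeqHomEquiv X F.obj)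
      homEquiv_naturality_left_symm {X Y F} f g := by
        ext i
        by_cases hi : i.unop ≤ 0
        · refine (trivialSeqHom_app _ _ _ hi).trans (Eq.trans ?_ (congrArg₂ (· ≫ ·)
            (E.trivialFil_map_app f i.unop hi) (trivialSeqHom_app _ _ _ hi)).symm)
          have key {P Q R : A} (a : P ⟶ X) (b : Q ≅ Y) (h : Y ⟶ R) :
              a ≫ f ≫ h = (a ≫ f ≫ b.inv) ≫ b.hom ≫ h := by simp
          exact (congrArg (_ ≫ ·) (assoc _ _ _)).trans (key _ _ _)
        · exact (isZero_trivialSeq_obj _ i hi).eq_of_src _ _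
      homEquiv_naturality_right _ _ := (assoc _ _ _).symm }

instance (X : A) : IsIso (E.trivialFilAdj.unit.app X) := by
  have : E.trivialFilAdj.unit.app X = (trivialSeqObjIso X (Opposite.op 0) le_rfl).inv :=
    comp_id _
  rw [this]
  exact Iso.isIso_inv _

instance : IsIso E.trivialFilAdj.unit := NatIso.isIso_of_isIso_app _

instance : E.trivialFil.Faithful := E.trivialFilAdj.faithful_L_of_mono_unit_app

instance : E.trivialFil.Full := E.trivialFilAdj.fullyFaithfulLOfIsIsoUnit.full

variable [HasBinaryBiproducts A]

/-- The adjunction `trivialFilAdj`, on homotopy categories of complexes. -/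
def trivialKFAdj : E.trivialKF ⊣ E.stepK 0 :=
  (E.trivialFilAdj.mapHomotopyCategory (ComplexShape.up ℤ)).restrictFullyFaithful
    (iC := 𝟭 _) (iD := E.finitelyFiltered.ι) (Functor.FullyFaithful.id _)
    E.finitelyFiltered.fullyFaithfulι (Iso.refl _) (Iso.refl _)

instance : E.trivialKF.Faithful := by dsimp only [trivialKF]; infer_instance

instance : E.trivialKF.Full := by dsimp only [trivialKF]; infer_instance

/-- The adjunction `trivialFilAdj`, on derived categories. -/
def trivialDFAdj : E.trivialDF ⊣ E.stepDF 0 :=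
  letI : CatCommSq E.trivialKF E.Q E.QF E.trivialDF := ⟨E.QFCompTrivialDF⟩
  letI : CatCommSq (E.stepK 0) E.QF E.Q (E.stepDF 0) := ⟨(E.QFCompStepDF 0).symm⟩
  E.trivialKFAdj.localization E.Q E.acyclicThick.trW E.QF E.filteredAcyclic.trW _ _

instance : IsIso E.trivialDFAdj.unit := by
  let : CatCommSq E.trivialKF E.Q E.QF E.trivialDF := ⟨E.QFCompTrivialDF⟩
  let : CatCommSq (E.stepK 0) E.QF E.Q (E.stepDF 0) := ⟨(E.QFCompStepDF 0).symm⟩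
  have key (X : HomotopyCategory A (ComplexShape.up ℤ)) :
      IsIso (E.trivialDFAdj.unit.app (E.Q.obj X)) := by
    rw [trivialDFAdj, Adjunction.localization_unit_app]
    infer_instance
  have (X : E.D) : IsIso (E.trivialDFAdj.unit.app X) :=
    (NatTrans.isIso_app_iff_of_iso _ (E.Q.objObjPreimageIso X)).1 (key _)
  exact NatIso.isIso_of_isIso_app _

instance : E.trivialDF.Faithful := E.trivialDFAdj.fullyFaithfulLOfIsIsoUnit.faithful

instance : E.trivialDF.Full := E.trivialDFAdj.fullyFaithfulLOfIsIsoUnit.full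

lemma isZero_grDF_trivialDF (X : E.D) (i : ℤ) (hi : i ≠ 0) :
    IsZero ((E.grDF i).obj (E.trivialDF.obj X)) :=
  ((E.isZero_grDF_QF_iff i _).2 (E.isZero_grKF_trivialKF i hi (E.Q.objPreimage X))).of_iso
    ((E.grDF i).mapIso (E.trivialDF.mapIso (E.Q.objObjPreimageIso X).symm ≪≫
      (E.QFCompTrivialDF.symm.app _)))

/-- `Gr⁰` of the trivial filtration is the identity of `D(A)`. -/
def trivialDFCompGrDF : E.trivialDF ⋙ E.grDF 0 ≅ 𝟭 E.D :=
  letI : Localization.Lifting E.Q E.acyclicThick.trW (E.trivialKF ⋙ E.grKF 0)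
      (E.trivialDF ⋙ E.grDF 0) :=
    ⟨(Functor.associator _ _ _).symm ≪≫ Functor.isoWhiskerRight E.QFCompTrivialDF.symm _ ≪≫
      Functor.associator _ _ _ ≪≫ Functor.isoWhiskerLeft _ (E.QFCompGrDF 0)⟩
  Localization.liftNatIso E.Q E.acyclicThick.trW (E.trivialKF ⋙ E.grKF 0) E.Q _ _
    E.trivialKFCompGr

/-- If only `Gr⁰ X` may be nonzero, then `F¹ X = 0`, so that `F⁰ X = Gr⁰ X`. -/
lemma isZero_of_isZero_stepDF (X : E.DF) (h : ∀ i ≠ 0, IsZero ((E.grDF i).obj X))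
    (h₀ : IsZero ((E.stepDF 0).obj X)) : IsZero X := by
  have e := E.QF.objObjPreimageIso X
  have h' (i : ℤ) (hi : i ≠ 0) : IsZero ((E.grKF i).obj (E.QF.objPreimage X)) :=
    (E.isZero_grDF_QF_iff i _).1 ((h i hi).of_iso ((E.grDF i).mapIso e))
  have h₀' : IsZero ((E.stepKF 0).obj (E.QF.objPreimage X)) :=
    h₀.of_iso (((E.QFCompStepDF 0).symm.app _) ≪≫ (E.stepDF 0).mapIso e)
  refine E.isZero_of_isZero_grDF X fun i => ?_
  by_cases hi : i = 0
  · subst hi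
    refine ((E.isZero_grDF_QF_iff 0 _).2 (E.isZero_grKF_of_isZero_stepKF 0 _ ?_ h₀')).of_iso
      ((E.grDF 0).mapIso e.symm)
    exact E.isZero_stepKF_of_isZero_grKF _ _ fun i hi => h' i (by lia)
  · exact h i hi

/-- The essential image of `j` consists of the objects `X` with a single graded piece, in
degree `0`: the cone of the counit `j (F⁰ X) ⟶ X` is such an object too, and it is killed by
`F⁰`. -/
lemma exists_trivialDF_iso (X : E.DF) (h : ∀ i ≠ 0, IsZero ((E.grDF i).obj X)) :
    ∃ Y, Nonempty (E.trivialDF.obj Y ≅ X) := by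
  refine ⟨(E.stepDF 0).obj X, ?_⟩
  obtain ⟨L, b, c, hT⟩ := distinguished_cocone_triangle (E.trivialDFAdj.counit.app X)
  have h₁ : IsIso ((E.stepDF 0).map (E.trivialDFAdj.counit.app X)) := by
    have := E.trivialDFAdj.right_triangle_components X
    exact IsIso.of_isIso_fac_left this
  have hL : IsZero L := by
    refine E.isZero_of_isZero_stepDF L (fun i hi => ?_) ?_
    · exact Triangle.isZero₃_of_isZero₁₂ _ ((E.grDF i).map_distinguished _ hT)
        (E.isZero_grDF_trivialDF _ i hi) (h i hi)
    · exact Triangle.isZero₃_of_isIso₁ _ ((E.stepDF 0).map_distinguished _ hT) h₁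
  have : IsIso (E.trivialDFAdj.counit.app X) := (Triangle.isZero₃_iff_isIso₁ _ hT).1 hL
  exact ⟨asIso (E.trivialDFAdj.counit.app X)⟩

end ExactStructure

/-! ### The filtered derived category as an f-category -/

/-- The objects `Y` such that all morphisms `Y ⟶ K` are zero are closed under extensions. -/
lemma isTriangulatedClosed₂_hom_eq_zero {T : Type*} [Category* T] [HasZeroObject T]
    [HasShift T ℤ] [Preadditive T] [∀ n : ℤ, (shiftFunctor T n).Additive] [Pretriangulated T]
    (K : T) : ObjectProperty.IsTriangulatedClosed₂ (fun Y : T => ∀ φ : Y ⟶ K, φ = 0) :=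
  .mk fun Tr hT h₁ h₃ => ObjectProperty.le_isoClosure _ _ fun φ => by
    obtain ⟨ψ, rfl⟩ := Triangle.yoneda_exact₂ Tr hT φ (h₁ _)
    rw [h₃ ψ, comp_zero]

namespace ExactStructure

variable {A : Type u} [Category.{v} A] [Preadditive A] (E : ExactStructure A) [HasZeroObject A]
  [HasBinaryBiproducts A]

/-- A morphism `X ⟶ K` is zero if for every `n`, either `Grⁿ X = 0` or `Fⁿ K = 0`. By dévissage,
`X` may be assumed to have a single graded piece, and, after a shift of the filtration, to be of the
form `j Y`; then `Hom(j Y, K) = Hom(Y, F⁰ K)`. -/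
lemma hom_eq_zero_of_isZero_stepDF {X K : E.DF}
    (h : ∀ n, IsZero ((E.grDF n).obj X) ∨ IsZero ((E.stepDF n).obj K)) (φ : X ⟶ K) : φ = 0 := by
  obtain ⟨a, b, ha, hb⟩ := E.bounded_grDF X
  let S : ObjectProperty E.DF := fun Y => ∀ φ : Y ⟶ K, φ = 0
  have : S.IsTriangulatedClosed₂ := isTriangulatedClosed₂_hom_eq_zero K
  have : S.IsClosedUnderIsomorphisms :=
    ⟨fun e hX φ => by rw [← cancel_epi e.hom, hX (e.hom ≫ φ), comp_zero]⟩
  have : S.ContainsZero := ⟨0, isZero_zero _, fun φ => (isZero_zero _).eq_of_src _ _⟩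
  have : E.fDF.s.IsEquivalence := inferInstanceAs E.shiftDF.IsEquivalence
  refine FData.prop_of_graded_pieces (E.isGradedBy_grDF.hasTruncation E.hasTruncation_grDF)
    E.isZero_of_isZero_grDF S ha hb (fun n B _ hB ⟨ε⟩ ψ => ?_) φ
  obtain hX | hK := h n
  · exact (E.isZero_of_isZero_grDF B fun i => by
      by_cases hi : i = n
      · subst hi
        exact hX.of_iso ε
      · exact hB i hi).eq_of_src _ _
  · let e := E.shiftDF.asEquivalence ^ n
    obtain ⟨Y, ⟨ε'⟩⟩ := E.exists_trivialDF_iso (e.inverse.obj B) (fun i hi =>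
      (E.isGradedBy_grDF.isZero_inverse_obj_iff n i B).2 (hB _ (by lia)))
    have h₀ : IsZero ((E.stepDF 0).obj (e.inverse.obj K)) :=
      hK.of_iso (FData.nonempty_pow_inverse_obj_iso E.shiftDF.asEquivalence
        (fun i => ⟨E.shiftDFCompStepDF i⟩) n 0 n (by lia) K).some
    apply e.inverse.map_injective
    rw [← cancel_epi ε'.hom]
    exact (E.trivialDFAdj.homEquiv _ _).injective (h₀.eq_of_tgt _ _)

lemma isZero_stepDF_of_isZero_grDF (n : ℤ) (X : E.DF)
    (hX : ∀ i, n ≤ i → IsZero ((E.grDF i).obj X)) : IsZero ((E.stepDF n).obj X) := by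
  have e := E.QF.objObjPreimageIso X
  refine (E.isZero_stepKF_of_isZero_grKF n (E.QF.objPreimage X) fun i hi => ?_).of_iso
    ((E.stepDF n).mapIso e.symm ≪≫ (E.QFCompStepDF n).app _)
  exact (E.isZero_grDF_QF_iff i _).1 ((hX i hi).of_iso ((E.grDF i).mapIso e))

/-- The map `Fⁿ X ⟶ Fⁿ (sX)` is the transition morphism `Fⁿ ⟶ Fⁿ⁻¹`, whose cone is `Grⁿ⁻¹ X`. -/
lemma isIso_stepDF_map_iotaDF (n : ℤ) (X : E.DF) (hX : IsZero ((E.grDF (n - 1)).obj X)) :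
    IsIso ((E.stepDF n).map (E.iotaDF.app X)) := by
  have e := E.QF.objObjPreimageIso X
  have h (k : ℤ) (hk : k + 1 = n) (hZ : IsZero ((E.grKF k).obj (E.QF.objPreimage X))) :
      IsIso (E.Q.map ((NatTrans.mapHomotopyCategory (E.filTrans n k (by lia))
        (ComplexShape.up ℤ)).app (E.QF.objPreimage X).obj)) := by
    subst hk
    exact (E.isIso_stepTrans_iff k _).2 hZ
  have h₁ : IsIso ((E.stepKF n).map (E.iotaKF.app (E.QF.objPreimage X))) :=
    h (n - 1) (by lia) ((E.isZero_grDF_QF_iff _ _).1 (hX.of_iso ((E.grDF _).mapIso e)))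
  have h₂ : IsIso ((E.stepDF n).map (E.QF.map (E.iotaKF.app (E.QF.objPreimage X)))) :=
    (NatIso.isIso_map_iff (E.QFCompStepDF n) _).2 h₁
  have h₃ : IsIso ((E.stepDF n).map (E.iotaDF.app (E.QF.obj (E.QF.objPreimage X)))) := by
    rw [iotaDF_app_QF, Functor.map_comp]
    infer_instance
  exact (NatTrans.isIso_app_iff_of_iso (Functor.whiskerRight E.iotaDF (E.stepDF n)) e).1 h₃

lemma hom_eq_zero_of_isZero_grDF {X Y : E.DF} (hX : ∀ i ≤ 0, IsZero ((E.grDF i).obj X))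
    (hY : ∀ i, 0 < i → IsZero ((E.grDF i).obj Y)) (φ : X ⟶ Y) : φ = 0 :=
  E.hom_eq_zero_of_isZero_stepDF (fun n => (le_or_gt n 0).imp (hX n) fun hn =>
    E.isZero_stepDF_of_isZero_grDF n Y fun i hi => hY i (by lia)) φ

/-- As `Fⁿ ι` is invertible for `n ≤ 0`, the cone of `ι : X ⟶ s X` and its translates receive no
nonzero morphism from `Y`. -/
lemma bijective_comp_iotaDF {X Y : E.DF} (hX : ∀ i < 0, IsZero ((E.grDF i).obj X))
    (hY : ∀ i, 0 < i → IsZero ((E.grDF i).obj Y)) :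
    Function.Bijective (fun φ : Y ⟶ X => φ ≫ E.iotaDF.app X) := by
  obtain ⟨K, b, c, hT⟩ := distinguished_cocone_triangle (E.iotaDF.app X)
  have hK (n : ℤ) (hn : n ≤ 0) : IsZero ((E.stepDF n).obj K) :=
    Triangle.isZero₃_of_isIso₁ _ ((E.stepDF n).map_distinguished _ hT)
      (E.isIso_stepDF_map_iotaDF n X (hX _ (by lia)))
  have hK' (n : ℤ) (hn : n ≤ 0) : IsZero ((E.stepDF n).obj (K⟦(-1 : ℤ)⟧)) :=
    ((shiftFunctor E.D (-1 : ℤ)).map_isZero (hK n hn)).of_iso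
      (((E.stepDF n).commShiftIso (-1 : ℤ)).app K)
  have hYK {K : E.DF} (hK : ∀ n ≤ 0, IsZero ((E.stepDF n).obj K)) (ψ : Y ⟶ K) : ψ = 0 :=
    E.hom_eq_zero_of_isZero_stepDF (fun n => (lt_or_ge 0 n).imp (hY n) (hK n)) ψ
  refine ⟨fun φ φ' hφ => ?_, fun ψ => ?_⟩
  · obtain ⟨ψ, hψ⟩ := Triangle.coyoneda_exact₂ _ (inv_rot_of_distTriang _ hT) (φ - φ')
      ((Preadditive.sub_comp _ _ _).trans (sub_eq_zero.2 hφ))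
    exact sub_eq_zero.1 (hψ.trans ((congrArg (· ≫ _) (hYK hK' ψ)).trans zero_comp))
  · obtain ⟨φ, hφ⟩ := Triangle.coyoneda_exact₂ _ hT ψ (hYK hK _)
    exact ⟨φ, hφ.symm⟩

lemma isGradedFCategory_fDF : E.fDF.IsGradedFCategory E.grDF where
  toIsGradedBy := E.isGradedBy_grDF
  isEquivalence_s := inferInstanceAs E.shiftDF.IsEquivalence
  isTriangulated_s := inferInstanceAs E.shiftDF.IsTriangulated
  bounded := E.bounded_grDF
  iota_s := E.iotaDF_app_shiftDF
  hom_eq_zero := E.hom_eq_zero_of_isZero_grDF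
  bijective := E.bijective_comp_iotaDF
  truncation := E.hasTruncation_grDF

end ExactStructure

end

theorem corollary2p7 {A : Type u} [Category.{v} A] [Preadditive A] [HasZeroObject A]
    [HasBinaryBiproducts A] (E : ExactStructure A)
    (C : ObjectProperty E.D) [C.IsTriangulated] :
    E.fDF.IsFCategoryOver E.trivialDF ∧
      ∃! P : ObjectProperty E.DF, E.fDF.IsSubFCategoryOver E.trivialDF C P :=
  ⟨E.isGradedFCategory_fDF.isFCategoryOver (fun X i hi => E.isZero_grDF_trivialDF X i hi)
      E.exists_trivialDF_iso,
    _, E.isGradedFCategory_fDF.isSubFCategoryOver_gradedIn E.trivialDFCompGrDF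
      (fun X i hi => E.isZero_grDF_trivialDF X i hi) E.exists_trivialDF_iso C,
    fun P hP => E.isGradedFCategory_fDF.eq_gradedIn E.trivialDFCompGrDF
      (fun X i hi => E.isZero_grDF_trivialDF X i hi) E.exists_trivialDF_iso C P hP⟩
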